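/- **Model.** There are $n$ items, one seller and one buyer. A valuation is a function $v:2^{[n]}\to\mathbb R_{\ge 0}$; it is *XOS* if $v(S)=\max_{j\in\{1,\dots,d\}}\sum_{i\in S}a_{j,i}$ for some $d\ge 1$ and $a_{j,i}\ge 0$. A prior $\mathcal D$ over valuations has *independent items* if it is the law of $V(a_1,\dots,a_n)$, where the $a_i\sim\mathcal D_i$ are independent and, for every $S\subseteq[n]$, the value $V(a_1,\dots,a_n)(S)$ depends only on $(a_i)_{i\in S}$. An *auction protocol* is a (possibly infinite) binary tree whose internal nodes are labelled Buyer or Chance, each Chance node carrying a probability distribution on its two children and each leaf carrying a bundle $Y\subseteq[n]$ and a payment $q\ge 0$, together with a suggested strategy for every valuation $v$ (a strategy chooses a child at every Buyer node). The protocol is *finite* if it ends with probability $1$ under every strategy, and *individually rational* if some strategy guarantees the empty bundle and expected payment $0$. For $\varepsilon\ge 0$ it is *$\varepsilon$-almost truthful in expectation* for $\mathcal D$ if it is finite and individually rational and, for every $v$ in the support of $\mathcal D$, no strategy has expected net utility $\mathbb E[v(Y)]-\mathbb E[q]$ exceeding that of the strategy suggested for $v$ by more than $\varepsilon$; for $\varepsilon=0$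 it is *truthful in expectation*. Its *revenue* on $\mathcal D$ is its expected payment when $v\sim\mathcal D$ and the buyer follows the suggested strategy. $\mathrm{OPT}(\mathcal D)$ is the supremum of the revenue on $\mathcal D$ over all protocols that are truthful in expectation for $\mathcal D$. The number of bits exchanged is the depth of the leaf that is reached. **Theorem.** For every $\tau>0$ there are constants $c>0$, $\varepsilon>0$ and $n_0$, depending only on $\tau$, such that for every $n\ge n_0$ there is a (discrete) prior $\mathcal D$ with independent items, supported on XOS valuations over $n$ items with values in $[0,1]$, for which the following holds. Every auction protocol that is $\varepsilon$-almost truthful in expectation for $\mathcal D$ (in particular, every truthful-in-expectation one) and whose revenue on $\mathcal D$ is at least $\left(\frac45+\tau\right)\mathrm{OPT}(\mathcal D)$ uses at least $2^{cn}$ bits in expectation: this holds for the ex ante expectation, over $v\sim\mathcal D$ and over Chance, under the suggested strategies, and hence also for the expectation over Chance under a worst-case strategy of the buyer. -/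

import Mathlib

open scoped NNReal ENNReal

noncomputable section

/-- A valuation over the `n` items `Fin n`: a nonnegative value for every bundle. -/
abbrev BundleValuation (n : ℕ) : Type := Finset (Fin n) → ℝ≥0

/-- XOS (fractionally subadditive) valuations: a maximum of finitely many nonnegative additive
functions (the clauses `a 0, …, a (d - 1)`). -/
def IsXOS {n : ℕ} (v : BundleValuation n) : Prop :=
  ∃ (d : ℕ) (a : Fin d → Fin n → ℝ≥0), 0 < d ∧
    ∀ S : Finset (Fin n), v S = Finset.univ.sup fun j => ∑ i ∈ S, a j i

/-- A prior `D` over valuations has (a latent structure of) independent items: there are latent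
distributions `P i`, one per item, and a rule `V` such that `D` is the law of `V a` when the
coordinates `a i` are drawn independently from `P i`, and such that the value `V a S` of a bundle
depends only on the coordinates `a i` with `i ∈ S`. -/
def HasIndependentItems {n : ℕ} (D : PMF (BundleValuation n)) : Prop :=
  ∃ (A : Fin n → Type) (P : ∀ i, PMF (A i)) (V : (∀ i, A i) → BundleValuation n),
    (∀ (S : Finset (Fin n)) (a a' : ∀ i, A i), (∀ i ∈ S, a i = a' i) → V a S = V a' S) ∧
    ∀ v : BundleValuation n, D v = ∑' a : {a : ∀ i, A i // V a = v}, ∏ i, P i (a.1 i)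

/-- Labels of the nodes of a protocol tree. A Chance node carries the probability `p` of its
`true` child (the `false` child has probability `1 - p`); a leaf carries the bundle given to the
Buyer and the (nonnegative) payment. -/
inductive ProtocolNode (n : ℕ) : Type
  | buyer : ProtocolNode n
  | chance (p : ℝ≥0) (hp : p ≤ 1) : ProtocolNode n
  | leaf (alloc : Finset (Fin n)) (pay : ℝ≥0) : ProtocolNode n

/-- A Buyer's strategy: a choice of child at every node (only its values at Buyer's nodes
matter). -/
abbrev BuyerStrategy : Type := List Bool → Bool

/-- A possibly infinite binary protocol tree. Nodes are addressed by the bits sent so far, most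
recent bit first: the root is `[]` and the children of `w` are `true :: w` and `false :: w`.
Labels at addresses below a leaf are irrelevant, since such addresses are never reached. -/
structure ProtocolTree (n : ℕ) : Type where
  node : List Bool → ProtocolNode n

namespace ProtocolTree

variable {n : ℕ} (T : ProtocolTree n)

/-- The probability of moving from the node `w` to its child `b :: w` under the strategy `s`. -/
def step (s : BuyerStrategy) (w : List Bool) (b : Bool) : ℝ≥0∞ :=
  match T.node w with
  | .buyer => if s w = b then 1 else 0
  | .chance p _ => if b then (p : ℝ≥0∞) else 1 - (p : ℝ≥0∞)
  | .leaf _ _ => 0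

/-- The probability that the node `w` is visited under the strategy `s`. -/
def reach (s : BuyerStrategy) : List Bool → ℝ≥0∞
  | [] => 1
  | b :: w => reach s w * T.step s w b

/-- The expectation over Chance, under the strategy `s`, of a function `f w alloc pay` of the leaf
at which the protocol ends (runs that never end contribute nothing). -/
def leafExpectation (s : BuyerStrategy) (f : List Bool → Finset (Fin n) → ℝ≥0 → ℝ≥0∞) : ℝ≥0∞ :=
  ∑' w : List Bool,
    match T.node w with
    | .leaf alloc pay => T.reach s w * f w alloc pay
    | _ => 0

/-- The probability that the protocol ends after finitely many rounds. -/
def terminationProb (s : BuyerStrategy) : ℝ≥0∞ := T.leafExpectation s fun _ _ _ => 1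

/-- The expected payment. -/
def expectedPayment (s : BuyerStrategy) : ℝ≥0∞ := T.leafExpectation s fun _ _ q => (q : ℝ≥0∞)

/-- The expected value (before payment) of the bundle received by a Buyer with valuation `v`. -/
def expectedValue (v : BundleValuation n) (s : BuyerStrategy) : ℝ≥0∞ :=
  T.leafExpectation s fun _ Y _ => (v Y : ℝ≥0∞)

/-- The expected number of bits exchanged, by Buyer and Chance together: the expected depth of the
leaf that is reached. -/
def expectedDepth (s : BuyerStrategy) : ℝ≥0∞ :=
  T.leafExpectation s fun w _ _ => (w.length : ℝ≥0∞)

/-- The protocol is finite: it ends with probability one under every Buyer's strategy. -/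
def IsFinite : Prop := ∀ s : BuyerStrategy, T.terminationProb s = 1

/-- The protocol is individually rational: some strategy of the Buyer guarantees expected payment
`0` and the empty allocation. -/
def IsIR : Prop :=
  ∃ s : BuyerStrategy, T.expectedPayment s = 0 ∧
    ∀ (w : List Bool) (Y : Finset (Fin n)) (q : ℝ≥0),
      T.node w = .leaf Y q → T.reach s w ≠ 0 → Y = ∅

end ProtocolTree

/-- An auction protocol: a protocol tree and a suggested strategy for every type of the Buyer. -/
structure AuctionProtocol (n : ℕ) : Type extends ProtocolTree n where
  suggested : BundleValuation n → BuyerStrategy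

namespace AuctionProtocol

variable {n : ℕ} (M : AuctionProtocol n) (D : PMF (BundleValuation n))

/-- `ε`-almost truthful in expectation for the prior `D`: the protocol is finite and individually
rational, and for every type `v` in the support of `D` no strategy `s` has expected net utility
(expected value minus expected payment) exceeding that of the suggested strategy by more than `ε`.
The inequality `value s - payment s ≤ value (suggested v) - payment (suggested v) + ε` is written
without subtractions, so that it is also correct when an expected payment is infinite. -/
def IsAlmostIC (ε : ℝ≥0) : Prop :=
  M.IsFinite ∧ M.IsIR ∧
    ∀ v ∈ D.support, ∀ s : BuyerStrategy,
      M.expectedValue v s + M.expectedPayment (M.suggested v) ≤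
        M.expectedValue v (M.suggested v) + M.expectedPayment s + ε

/-- Truthful in expectation (incentive compatible) for the prior `D`. -/
def IsIC : Prop := M.IsAlmostIC D 0

/-- The expected revenue under the suggested strategies, for a Buyer drawn from `D`. -/
def revenue : ℝ≥0∞ := ∑' v : BundleValuation n, D v * M.expectedPayment (M.suggested v)

/-- Ex ante expected communication: the expected number of bits under the suggested strategies,
over the type of the Buyer and over Chance. -/
def exAnteCommunication : ℝ≥0∞ := ∑' v : BundleValuation n, D v * M.expectedDepth (M.suggested v)

/-- Expected communication complexity: the expected number of bits, over Chance, for a worst-case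
strategy of the Buyer. -/
def communicationComplexity : ℝ≥0∞ := ⨆ s : BuyerStrategy, M.expectedDepth s

end AuctionProtocol

/-- The optimal revenue for the prior `D`: the supremum of the expected revenue over all protocols,
with no bound on communication, that are finite, individually rational and truthful in
expectation. -/
def optimalRevenue {n : ℕ} (D : PMF (BundleValuation n)) : ℝ≥0∞ :=
  ⨆ (M : AuctionProtocol n) (_ : M.IsIC D), M.revenue D

end

/-!
The prior puts all uncertainty on item `0`. A type consists of a level, low or high, and of a word
`f`, which singles out one bundle `S y (f y)` for each position `y`. In units of `1 / 3`, item `0`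
is worth `1` to low types and `2` to high types, the other items alone are worth at most `1` to
everybody in the same known way, and on top of item `0` only the bundles singled out by the word
are worth another `1`. Both the bundles and the words come from Gilbert–Varshamov codes
(`exists_code`), so there are `2 ^ Ω(n)` bundles with small overlaps and doubly exponentially many
words, any two of which rarely agree.

*Optimal revenue.* Let a low type buy the uniform lottery over its own bundles at price `2`, and a
high type everything at a price slightly below `3`. To a high type, whose word is different, the
lottery of a low type is worth hardly more than `2`, so this is truthful, and the revenue is nearly
`5 / 2` (`le_optimalRevenue_codeValuation`).

*Short protocols.* Let `Φ f` be the best utility of a high type with word `f`, where value counts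
only at leaves of depth less than `K`. If, in a protocol of expected length much below `K`, the
high type could imitate a low type with *the same* word, then low payment plus high payment would
be at most `4` (`revenue_le_of_fooled`): on the low type's bundle the high type gains `1` more if
it contains item `0`, and the low type pays at most `2` then and at most `1` otherwise. High and
low types have different words, but `Φ` cannot notice this. Up to a small error, `Φ` belongs to a
class of at most `2 ^ (2 ^ K * O(K + n))` functions, obtained from the utilities of single leaves
on a grid by `K` rounds of maxima (Buyer nodes) and sums (Chance nodes)
(`exists_mem_utilityClass_approx`). Arrange the words in pairs and decide by fair coins which word
of each pair is given to a low type and which to a high type: by Chernoff's bound and a union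
bound, some outcome of the coins balances all functions of this class (`exists_signs_fooling`),
because the number of pairs is doubly exponential in `n`, and `2 ^ K` is only about its square
root. Hence short protocols earn hardly more than `2` on average, a fraction `4 / 5` of the
optimum.
-/

noncomputable section

/-! ### Recursion on the first move of a protocol -/

/-- The strategy that `s` induces after the first bit `b`. -/
def BuyerStrategy.child (s : BuyerStrategy) (b : Bool) : BuyerStrategy := fun w => s (w ++ [b])

/-- The strategy that sends `b₀` at the root and then plays `s b` after the first bit `b`. -/
def BuyerStrategy.branch (b₀ : Bool) (s : Bool → BuyerStrategy) : BuyerStrategy := fun w =>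
  if h : w = [] then b₀ else s (w.getLast h) w.dropLast

@[simp] lemma BuyerStrategy.branch_nil (b₀ : Bool) (s : Bool → BuyerStrategy) :
    BuyerStrategy.branch b₀ s [] = b₀ := rfl

@[simp] lemma BuyerStrategy.child_branch (b₀ b : Bool) (s : Bool → BuyerStrategy) :
    (BuyerStrategy.branch b₀ s).child b = s b := by
  funext w
  simp [BuyerStrategy.child, BuyerStrategy.branch]

/-- A sum over all addresses, split according to the oldest bit of the address. -/
lemma tsum_list_bool_eq (g : List Bool → ℝ≥0∞) :
    ∑' w, g w = g [] + ∑ b, ∑' w, g (w ++ [b]) := by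
  let e : Unit ⊕ (Bool × List Bool) ≃ List Bool :=
    { toFun := Sum.elim (fun _ => []) fun p => p.2 ++ [p.1]
      invFun := fun w => if h : w = [] then .inl () else .inr (w.getLast h, w.dropLast)
      left_inv := by rintro (_ | ⟨b, w⟩) <;> simp
      right_inv := by
        intro w
        by_cases h : w = []
        · simp [h]
        · simp [h, List.dropLast_append_getLast] }
  rw [← e.tsum_eq, Summable.tsum_sum ENNReal.summable ENNReal.summable, ENNReal.tsum_prod',
    tsum_fintype, tsum_fintype, Fintype.sum_unique]
  rfl

namespace ProtocolTree

variable {n : ℕ}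

/-- The subprotocol that remains after the first bit `b`. -/
def child (T : ProtocolTree n) (b : Bool) : ProtocolTree n := ⟨fun w => T.node (w ++ [b])⟩

/-- The protocol with root label `x` that continues with `T b` after the first bit `b`. -/
def branch (x : ProtocolNode n) (T : Bool → ProtocolTree n) : ProtocolTree n :=
  ⟨fun w => if h : w = [] then x else (T (w.getLast h)).node w.dropLast⟩

@[simp] lemma child_branch (x : ProtocolNode n) (T : Bool → ProtocolTree n) (b : Bool) :
    (branch x T).child b = T b := by
  simp [child, branch]

variable (T : ProtocolTree n) (s : BuyerStrategy)

lemma reach_append (w : List Bool) (b : Bool) :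
    T.reach s (w ++ [b]) = T.step s [] b * (T.child b).reach (s.child b) w := by
  induction w with
  | nil => simp [reach]
  | cons c w ih =>
    change T.reach s (w ++ [b]) * T.step s (w ++ [b]) c = _
    rw [ih, mul_assoc]
    rfl

/-- The expectation restricted to runs with first bit `b` is the expectation in a subprotocol. -/
lemma leafExpectation_eq (f : List Bool → Finset (Fin n) → ℝ≥0 → ℝ≥0∞) :
    T.leafExpectation s f =
      (match T.node [] with
        | .leaf Y q => f [] Y q
        | _ => 0) +
      ∑ b, T.step s [] b *
        (T.child b).leafExpectation (s.child b) fun w => f (w ++ [b]) := by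
  unfold leafExpectation
  rw [tsum_list_bool_eq]
  congr 1
  · cases T.node [] <;> simp [reach]
  · refine Finset.sum_congr rfl fun b _ => ?_
    rw [← ENNReal.tsum_mul_left]
    refine tsum_congr fun w => ?_
    change (match T.node (w ++ [b]) with | .leaf Y q => _ | _ => _) =
      _ * (match T.node (w ++ [b]) with | .leaf Y q => _ | _ => _)
    rw [reach_append]
    cases T.node (w ++ [b]) <;> simp [mul_assoc]

lemma leafExpectation_of_leaf {Y : Finset (Fin n)} {q : ℝ≥0} (h : T.node [] = .leaf Y q)
    (f : List Bool → Finset (Fin n) → ℝ≥0 → ℝ≥0∞) : T.leafExpectation s f = f [] Y q := by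
  rw [leafExpectation_eq]
  simp [step, h]

lemma leafExpectation_of_buyer (h : T.node [] = .buyer)
    (f : List Bool → Finset (Fin n) → ℝ≥0 → ℝ≥0∞) :
    T.leafExpectation s f =
      (T.child (s [])).leafExpectation (s.child (s [])) fun w => f (w ++ [s []]) := by
  rw [leafExpectation_eq]
  cases hs : s [] <;> simp [step, h, hs]

lemma leafExpectation_of_chance {p : ℝ≥0} {hp : p ≤ 1} (h : T.node [] = .chance p hp)
    (f : List Bool → Finset (Fin n) → ℝ≥0 → ℝ≥0∞) :
    T.leafExpectation s f =
      p * (T.child true).leafExpectation (s.child true) (fun w => f (w ++ [true])) +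
      (1 - p : ℝ≥0) *
        (T.child false).leafExpectation (s.child false) (fun w => f (w ++ [false])) := by
  rw [leafExpectation_eq]
  simp [step, h]

lemma leafExpectation_mono {f g : List Bool → Finset (Fin n) → ℝ≥0 → ℝ≥0∞}
    (h : ∀ w Y q, f w Y q ≤ g w Y q) : T.leafExpectation s f ≤ T.leafExpectation s g := by
  unfold leafExpectation
  refine ENNReal.tsum_le_tsum fun w => ?_
  cases T.node w <;> simp only [le_refl]
  gcongr
  exact h _ _ _

lemma leafExpectation_add (f g : List Bool → Finset (Fin n) → ℝ≥0 → ℝ≥0∞) :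
    T.leafExpectation s (fun w Y q => f w Y q + g w Y q) =
      T.leafExpectation s f + T.leafExpectation s g := by
  unfold leafExpectation
  rw [← ENNReal.tsum_add]
  refine tsum_congr fun w => ?_
  cases T.node w <;> simp [mul_add]

lemma leafExpectation_const_mul (c : ℝ≥0∞) (f : List Bool → Finset (Fin n) → ℝ≥0 → ℝ≥0∞) :
    T.leafExpectation s (fun w Y q => c * f w Y q) = c * T.leafExpectation s f := by
  unfold leafExpectation
  rw [← ENNReal.tsum_mul_left]
  refine tsum_congr fun w => ?_
  cases T.node w <;> simp [mul_left_comm]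

/-- The expected value of the bundle, counting only the runs with fewer than `K` bits. -/
def truncatedValue (v : BundleValuation n) (K : ℕ) (s : BuyerStrategy) : ℝ≥0∞ :=
  T.leafExpectation s fun w Y _ => if w.length < K then (v Y : ℝ≥0∞) else 0

lemma truncatedValue_le_expectedValue (v : BundleValuation n) (K : ℕ) :
    T.truncatedValue v K s ≤ T.expectedValue v s := by
  refine T.leafExpectation_mono s fun w Y q => ?_
  split_ifs <;> simp

/-- Markov's inequality for the number of bits: runs with at least `K` bits contribute little to
the expected value. -/
lemma mul_expectedValue_le (v : BundleValuation n) (hv : ∀ Y, v Y ≤ 1) (K : ℕ) :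
    K * T.expectedValue v s ≤ K * T.truncatedValue v K s + T.expectedDepth s := by
  unfold expectedValue truncatedValue expectedDepth
  rw [← leafExpectation_const_mul, ← leafExpectation_const_mul, ← leafExpectation_add]
  refine T.leafExpectation_mono s fun w Y q => ?_
  have hY : (v Y : ℝ≥0∞) ≤ 1 := by exact_mod_cast hv Y
  split_ifs with hw
  · exact le_self_add
  · push Not at hw
    calc (K : ℝ≥0∞) * v Y ≤ K * 1 := by gcongr
      _ ≤ _ := by simpa using hw

lemma expectedValue_le_one (hT : T.IsFinite) (v : BundleValuation n) (hv : ∀ Y, v Y ≤ 1) :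
    T.expectedValue v s ≤ 1 := by
  rw [← hT s]
  refine T.leafExpectation_mono s fun w Y q => ?_
  exact_mod_cast hv Y

/-- The probability of ending within fewer than `K` bits is at most one. -/
lemma leafExpectation_truncated_le (K : ℕ) :
    T.leafExpectation s (fun w _ _ => if w.length < K then 1 else 0) ≤ 1 := by
  induction K generalizing T s with
  | zero =>
    refine le_of_eq_of_le ?_ zero_le_one
    refine ENNReal.tsum_eq_zero.2 fun w => ?_
    cases T.node w <;> simp
  | succ K ih =>
    cases h : T.node [] with
    | leaf Y q => rw [leafExpectation_of_leaf T s h]; simp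
    | buyer =>
      rw [leafExpectation_of_buyer T s h]
      simpa using ih _ _
    | chance p hp =>
      rw [leafExpectation_of_chance T s h]
      simp only [List.length_append, List.length_singleton, Nat.add_lt_add_iff_right]
      calc _ ≤ (p : ℝ≥0∞) * 1 + (1 - p : ℝ≥0) * 1 := by gcongr <;> exact ih _ _
        _ = 1 := by
          rw [mul_one, mul_one, ← ENNReal.coe_add, add_tsub_cancel_of_le hp, ENNReal.coe_one]

lemma truncatedValue_le_one (v : BundleValuation n) (hv : ∀ Y, v Y ≤ 1) (K : ℕ) :
    T.truncatedValue v K s ≤ 1 := by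
  refine le_trans (T.leafExpectation_mono s fun w Y q => ?_) (T.leafExpectation_truncated_le s K)
  split_ifs
  · exact_mod_cast hv Y
  · exact le_rfl

end ProtocolTree

/-! ### Finite classes approximating the utilities in a truncated protocol -/

/-- Utilities `F ↦ a * h F Y - c` of a single leaf with bundle `Y`, reached with probability `a`
and of expected payment `c`, where `a` and `c` are restricted to the grid of mesh `1 / R`
in `[0, 1]` and `[0, 2]`, respectively. -/
def leafUtilities {W : Type*} {n : ℕ} (h : W → BundleValuation n) (R : ℕ) : Finset (W → ℝ) :=
  open Classical in
  ((Finset.univ : Finset (Finset (Fin n))) ×ˢ Finset.range (R + 1) ×ˢ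
    Finset.range (2 * R + 1)).image fun x F => (x.2.1 / R : ℝ) * h F x.1 - x.2.2 / R

/-- Optimal utilities, as functions of the type `F`, in protocols of depth `K` with grid leaves:
a Buyer node takes a maximum and a Chance node a sum (its probabilities are absorbed into the
leaves). -/
def utilityClass {W : Type*} {n : ℕ} (h : W → BundleValuation n) (R : ℕ) : ℕ → Finset (W → ℝ)
  | 0 => leafUtilities h R
  | K + 1 =>
    open Classical in
    leafUtilities h R ∪ (Finset.image₂ (fun g₁ g₂ F => max (g₁ F) (g₂ F))
        (utilityClass h R K) (utilityClass h R K) ∪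
      Finset.image₂ (fun g₁ g₂ F => g₁ F + g₂ F) (utilityClass h R K) (utilityClass h R K))

section Card

variable {W : Type*} {n : ℕ} (h : W → BundleValuation n) (R : ℕ)

lemma leafUtilities_card_le : (leafUtilities h R).card ≤ 2 ^ n * (R + 1) * (2 * R + 1) := by
  classical
  refine Finset.card_image_le.trans ?_
  simp [Finset.card_product, mul_assoc]

lemma leafUtilities_card_pos : 0 < (leafUtilities h R).card := by
  classical
  have : (fun F => ((0 : ℕ) / R : ℝ) * h F ∅ - (0 : ℕ) / R) ∈ leafUtilities h R :=
    Finset.mem_image.2 ⟨(∅, 0, 0), by simp, rfl⟩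
  exact Finset.card_pos.2 ⟨_, this⟩

lemma leafUtilities_subset (K : ℕ) : leafUtilities h R ⊆ utilityClass h R K := by
  classical
  cases K with
  | zero => exact subset_rfl
  | succ K => exact Finset.subset_union_left

lemma three_mul_utilityClass_card_le (K : ℕ) :
    3 * (utilityClass h R K).card ≤ (3 * (leafUtilities h R).card) ^ 2 ^ K := by
  classical
  induction K with
  | zero => simp [utilityClass]
  | succ K ih =>
    set x := (utilityClass h R K).card
    have hL : (leafUtilities h R).card ≤ x := Finset.card_le_card (leafUtilities_subset h R K)
    have hx : (leafUtilities h R).card ≤ x * x := by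
      have := leafUtilities_card_pos h R
      nlinarith
    have h1 : (utilityClass h R (K + 1)).card ≤ (leafUtilities h R).card + (x * x + x * x) := by
      refine (Finset.card_union_le _ _).trans (Nat.add_le_add_left ?_ _)
      refine (Finset.card_union_le _ _).trans (Nat.add_le_add ?_ ?_) <;>
      exact Finset.card_image₂_le _ _ _
    calc 3 * (utilityClass h R (K + 1)).card ≤ (3 * x) ^ 2 := by nlinarith
      _ ≤ ((3 * (leafUtilities h R).card) ^ 2 ^ K) ^ 2 := by gcongr
      _ = _ := by rw [← pow_mul, pow_succ]

end Card

/-- Rounding down to a multiple of `1 / R` in `[0, b]`. -/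
lemma exists_grid_point {R : ℕ} (hR : 0 < R) (b : ℕ) {x : ℝ} (hx : 0 ≤ x) (hxb : x ≤ b) :
    ∃ j < b * R + 1, (j / R : ℝ) ≤ x ∧ x ≤ j / R + 1 / R := by
  have hR' : (0 : ℝ) < R := by exact_mod_cast hR
  refine ⟨⌊x * R⌋₊, ?_, ?_, ?_⟩
  · rw [Nat.lt_succ_iff]
    refine Nat.floor_le_of_le ?_
    push_cast
    gcongr
  · rw [div_le_iff₀ hR']
    exact Nat.floor_le (by positivity)
  · rw [← add_div, le_div_iff₀ hR']
    exact (Nat.lt_floor_add_one _).le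

namespace ProtocolTree

variable {n : ℕ} (T : ProtocolTree n)

lemma truncatedValue_zero (v : BundleValuation n) (s : BuyerStrategy) :
    T.truncatedValue v 0 s = 0 := by
  refine ENNReal.tsum_eq_zero.2 fun w => ?_
  cases T.node w <;> simp

lemma truncatedValue_of_buyer (h : T.node [] = .buyer) (v : BundleValuation n) (K : ℕ)
    (s : BuyerStrategy) : T.truncatedValue v (K + 1) s =
      (T.child (s [])).truncatedValue v K (s.child (s [])) := by
  rw [truncatedValue, leafExpectation_of_buyer T s h]
  simp [truncatedValue]

lemma truncatedValue_of_chance {p : ℝ≥0} {hp : p ≤ 1} (h : T.node [] = .chance p hp)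
    (v : BundleValuation n) (K : ℕ) (s : BuyerStrategy) : T.truncatedValue v (K + 1) s =
      p * (T.child true).truncatedValue v K (s.child true) +
      (1 - p : ℝ≥0) * (T.child false).truncatedValue v K (s.child false) := by
  rw [truncatedValue, leafExpectation_of_chance T s h]
  simp [truncatedValue]

/-- Up to a small error, a function `g` from the finite class is the best utility that a Buyer of
type `h F` can achieve in the protocol, scaled by the probability `a` of being played, when only
the value of leaves of depth less than `K` counts. Costs are capped at `2`: this matters only where
the capped utility is negative already at the root. -/
lemma exists_mem_utilityClass_approx {W : Type*} (h : W → BundleValuation n)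
    (hh : ∀ F Y, h F Y ≤ 1) (R : ℕ) (hR : 0 < R) (K : ℕ) (a : ℝ≥0) (ha : a ≤ 1) :
    ∃ g ∈ utilityClass h R K, (∀ F, g F ≤ a) ∧
      (∀ F s, (a : ℝ≥0∞) * T.expectedPayment s ≠ ∞ →
        a * (T.truncatedValue (h F) K s).toReal - ((a : ℝ≥0∞) * T.expectedPayment s).toReal ≤
          g F + 2 ^ K * (2 / R)) ∧
      ∀ F, g F ≤ a - 2 + 2 ^ K * (2 / R) ∨
        ∃ s, (a : ℝ≥0∞) * T.expectedPayment s ≠ ∞ ∧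
          g F ≤ a * (T.truncatedValue (h F) K s).toReal -
            ((a : ℝ≥0∞) * T.expectedPayment s).toReal + 2 ^ K * (2 / R) := by
  classical
  have hR' : (0 : ℝ) < R := by exact_mod_cast hR
  have hinv : (0 : ℝ) < 1 / R := by positivity
  have htwo : (2 / R : ℝ) = 1 / R + 1 / R := by ring
  induction K generalizing T a with
  | zero =>
    -- no leaf counts at depth zero, and only the least payment that can still be made matters
    set c : ℝ≥0∞ := ⨅ s, (a : ℝ≥0∞) * T.expectedPayment s with hc
    have hmin : min c 2 ≠ ∞ := ne_top_of_le_ne_top (by simp) (min_le_right c 2)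
    obtain ⟨j, hj, hj1, hj2⟩ := exists_grid_point hR 2 (x := (min c 2).toReal)
      ENNReal.toReal_nonneg (by
        have := ENNReal.toReal_mono (by simp) (min_le_right c 2)
        simpa using this)
    refine ⟨fun F => ((0 : ℕ) / R : ℝ) * h F ∅ - j / R, ?_, ?_, ?_, ?_⟩
    · exact Finset.mem_image.2 ⟨(∅, 0, j), by simpa using hj, rfl⟩
    · intro F
      have : (0 : ℝ) ≤ j / R := by positivity
      have ha0 : (0 : ℝ) ≤ a := a.2
      simp
      linarith
    · intro F s hs
      have h1 : (min c 2).toReal ≤ ((a : ℝ≥0∞) * T.expectedPayment s).toReal :=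
        ENNReal.toReal_mono hs ((min_le_left _ _).trans (iInf_le _ s))
      simp only [truncatedValue_zero, pow_zero, one_mul, ENNReal.toReal_zero, mul_zero,
        Nat.cast_zero, zero_div, zero_mul]
      linarith
    · intro F
      simp only [truncatedValue_zero, pow_zero, one_mul, ENNReal.toReal_zero, mul_zero,
        Nat.cast_zero, zero_div, zero_mul]
      rcases le_or_gt 2 c with hc2 | hc2
      · left
        rw [min_eq_right hc2] at hj2
        have ha0 : (0 : ℝ) ≤ a := a.2
        have : (2 : ℝ≥0∞).toReal = 2 := by simp
        linarith
      · right
        rw [min_eq_left hc2.le] at hj1 hj2 hmin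
        have hlt : c < c + ENNReal.ofReal (1 / R) :=
          ENNReal.lt_add_right hmin (by simpa using hR.ne')
        obtain ⟨s, hs⟩ := iInf_lt_iff.1 hlt
        refine ⟨s, hs.ne_top, ?_⟩
        have h1 := ENNReal.toReal_mono (by simp [hmin]) hs.le
        rw [ENNReal.toReal_add hmin (by simp), ENNReal.toReal_ofReal hinv.le] at h1
        linarith
  | succ K ih =>
    have hpow : (0 : ℝ) ≤ 2 ^ K * (2 / R) := by positivity
    have hpow' : (2 : ℝ) ^ (K + 1) * (2 / R) = 2 ^ K * (2 / R) + 2 ^ K * (2 / R) := by ring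
    cases hnode : T.node [] with
    | leaf Y q =>
      obtain ⟨i, hi, hi1, hi2⟩ := exists_grid_point hR 1 (x := (a : ℝ)) a.2 (by simpa using ha)
      obtain ⟨j, hj, hj1, hj2⟩ := exists_grid_point hR 2 (x := min (a * q : ℝ) 2)
        (le_min (by positivity) (by norm_num)) (min_le_right _ _)
      have hpay : ∀ s, T.expectedPayment s = q := fun s => T.leafExpectation_of_leaf s hnode _
      have hval : ∀ v s, T.truncatedValue v (K + 1) s = v Y := fun v s => by
        rw [truncatedValue, T.leafExpectation_of_leaf s hnode]; simp
      have hK : (2 / R : ℝ) ≤ 2 ^ (K + 1) * (2 / R) :=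
        le_mul_of_one_le_left (by positivity) (one_le_pow₀ (by norm_num))
      simp only [hpay, hval, ENNReal.coe_toReal, ENNReal.toReal_mul]
      refine ⟨fun F => (i / R : ℝ) * h F Y - j / R, ?_, ?_, ?_, ?_⟩
      · refine leafUtilities_subset h R _ (Finset.mem_image.2 ⟨(Y, i, j), ?_, rfl⟩)
        simpa using ⟨by omega, by omega⟩
      all_goals
        intro F
        have h0 : (0 : ℝ) ≤ h F Y := (h F Y).2
        have h1 : (h F Y : ℝ) ≤ 1 := by exact_mod_cast hh F Y
        have hi0 : (0 : ℝ) ≤ i / R := by positivity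
        have hj0 : (0 : ℝ) ≤ j / R := by positivity
        have hup : (i / R : ℝ) * h F Y ≤ i / R := mul_le_of_le_one_right hi0 h1
      · linarith
      · intro s _
        have h2 : (a : ℝ) * h F Y ≤ (i / R + 1 / R) * h F Y := by gcongr
        have h3 : (1 / R : ℝ) * h F Y ≤ 1 / R := mul_le_of_le_one_right hinv.le h1
        have h4 := min_le_left (a * q : ℝ) 2
        rw [add_mul] at h2
        linarith
      · rcases le_or_gt 2 (a * q : ℝ) with hc2 | hc2
        · left
          rw [min_eq_right hc2] at hj2
          linarith
        · right
          rw [min_eq_left hc2.le] at hj2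
          have h2 : (i / R : ℝ) * h F Y ≤ a * h F Y := by gcongr
          exact ⟨fun _ => false, ENNReal.mul_ne_top (by simp) (by simp), by linarith⟩
    | buyer =>
      obtain ⟨g₁, hg₁, b₁, l₁, u₁⟩ := ih (T.child true) a ha
      obtain ⟨g₀, hg₀, b₀, l₀, u₀⟩ := ih (T.child false) a ha
      have hpay : ∀ s, T.expectedPayment s = (T.child (s [])).expectedPayment (s.child (s [])) :=
        fun s => T.leafExpectation_of_buyer s hnode _
      refine ⟨fun F => max (g₁ F) (g₀ F), ?_, fun F => max_le (b₁ F) (b₀ F), ?_, ?_⟩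
      · exact Finset.mem_union_right _ (Finset.mem_union_left _ (Finset.mem_image₂_of_mem hg₁ hg₀))
      · intro F s
        rw [hpay, T.truncatedValue_of_buyer hnode]
        have := le_max_left (g₁ F) (g₀ F)
        have := le_max_right (g₁ F) (g₀ F)
        cases s [] <;> intro hs
        · have := l₀ F _ hs; linarith
        · have := l₁ F _ hs; linarith
      · intro F
        -- the better of the two options is played
        have key : ∀ (b : Bool) (g : W → ℝ), (g F ≤ a - 2 + 2 ^ K * (2 / R) ∨
            ∃ s, (a : ℝ≥0∞) * (T.child b).expectedPayment s ≠ ∞ ∧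
              g F ≤ a * ((T.child b).truncatedValue (h F) K s).toReal -
                ((a : ℝ≥0∞) * (T.child b).expectedPayment s).toReal + 2 ^ K * (2 / R)) →
            (g F ≤ a - 2 + 2 ^ (K + 1) * (2 / R) ∨
            ∃ s, (a : ℝ≥0∞) * T.expectedPayment s ≠ ∞ ∧
              g F ≤ a * (T.truncatedValue (h F) (K + 1) s).toReal -
                ((a : ℝ≥0∞) * T.expectedPayment s).toReal + 2 ^ (K + 1) * (2 / R)) := by
          rintro b g (h1 | ⟨s, h1, h2⟩)
          · left; linarith
          · right
            refine ⟨.branch b fun _ => s, ?_⟩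
            rw [hpay, T.truncatedValue_of_buyer hnode]
            simp only [BuyerStrategy.branch_nil, BuyerStrategy.child_branch]
            exact ⟨h1, by linarith⟩
        rcases max_choice (g₁ F) (g₀ F) with hm | hm
        · simp only [hm]; exact key true g₁ (u₁ F)
        · simp only [hm]; exact key false g₀ (u₀ F)
    | chance p hp =>
      -- the probabilities are absorbed into the scales of the two subprotocols
      obtain ⟨g₁, hg₁, b₁, l₁, u₁⟩ := ih (T.child true) (a * p) (mul_le_one' ha hp)
      obtain ⟨g₀, hg₀, b₀, l₀, u₀⟩ := ih (T.child false) (a * (1 - p))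
        (mul_le_one' ha tsub_le_self)
      have hsum : ((a * p : ℝ≥0) : ℝ) + ((a * (1 - p) : ℝ≥0) : ℝ) = a := by
        rw [← NNReal.coe_add, ← mul_add, add_tsub_cancel_of_le hp, mul_one]
      have hpay : ∀ s, (a : ℝ≥0∞) * T.expectedPayment s =
          ((a * p : ℝ≥0) : ℝ≥0∞) * (T.child true).expectedPayment (s.child true) +
          ((a * (1 - p) : ℝ≥0) : ℝ≥0∞) * (T.child false).expectedPayment (s.child false) := by
        intro s
        have := T.leafExpectation_of_chance s hnode fun _ _ q => (q : ℝ≥0∞)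
        rw [expectedPayment, this, mul_add, ← mul_assoc, ← mul_assoc, ENNReal.coe_mul,
          ENNReal.coe_mul]
        rfl
      have hval : ∀ F s, (a : ℝ) * (T.truncatedValue (h F) (K + 1) s).toReal =
          ((a * p : ℝ≥0) : ℝ) * ((T.child true).truncatedValue (h F) K (s.child true)).toReal +
          ((a * (1 - p) : ℝ≥0) : ℝ) *
            ((T.child false).truncatedValue (h F) K (s.child false)).toReal := by
        intro F s
        have hfin : ∀ (T' : ProtocolTree n) s', T'.truncatedValue (h F) K s' ≠ ∞ := fun T' s' =>
          ne_top_of_le_ne_top (by simp) (T'.truncatedValue_le_one s' (h F) (hh F) K)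
        rw [T.truncatedValue_of_chance hnode, ENNReal.toReal_add
          (ENNReal.mul_ne_top (by simp) (hfin _ _)) (ENNReal.mul_ne_top (by simp) (hfin _ _)),
          ENNReal.toReal_mul, ENNReal.toReal_mul, ENNReal.coe_toReal, ENNReal.coe_toReal,
          NNReal.coe_mul, NNReal.coe_mul]
        ring
      refine ⟨fun F => g₁ F + g₀ F, ?_, ?_, ?_, ?_⟩
      · exact Finset.mem_union_right _ (Finset.mem_union_right _ (Finset.mem_image₂_of_mem hg₁ hg₀))
      · intro F
        have := b₁ F
        have := b₀ F
        linarith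
      · intro F s hs
        rw [hpay] at hs ⊢
        obtain ⟨hs1, hs0⟩ := ENNReal.add_ne_top.1 hs
        rw [hval, ENNReal.toReal_add hs1 hs0]
        have := l₁ F _ hs1
        have := l₀ F _ hs0
        linarith
      · intro F
        have hb1 := b₁ F
        have hb0 := b₀ F
        rcases u₁ F with h1 | ⟨s₁, h1, h1'⟩
        · left; linarith
        rcases u₀ F with h0 | ⟨s₀, h0, h0'⟩
        · left; linarith
        right
        refine ⟨.branch true fun b => if b then s₁ else s₀, ?_⟩
        rw [hpay, hval]
        simp only [BuyerStrategy.child_branch, if_true, Bool.false_eq_true, if_false]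
        refine ⟨ENNReal.add_ne_top.2 ⟨h1, h0⟩, ?_⟩
        rw [ENNReal.toReal_add h1 h0]
        linarith

end ProtocolTree

/-! ### Random signs fool every member of a small class -/

/-- Chernoff's bound and a union bound: if the class `G` is small, then the two members of each
pair `(j, true)`, `(j, false)` can be ordered such that the sums of every `g ∈ G` over the first
and over the second members almost agree. -/
lemma exists_signs_fooling {J : Type*} [Fintype J] [DecidableEq J] (G : Finset (J × Bool → ℝ))
    (hG : ∀ g ∈ G, ∀ x, 0 ≤ g x ∧ g x ≤ 1) (δ : ℝ) (hδ : 0 < δ)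
    (hcard : (G.card : ℝ) < Real.exp (δ ^ 2 * Fintype.card J / 2)) :
    ∃ σ : J → Bool, ∀ g ∈ G,
      ∑ j, (g (j, σ j) - g (j, !σ j)) ≤ δ * Fintype.card J := by
  have mgf : ∀ g ∈ G, ∑ σ : J → Bool, Real.exp (δ * ∑ j, (g (j, σ j) - g (j, !σ j))) ≤
      2 ^ Fintype.card J * Real.exp (δ ^ 2 * Fintype.card J / 2) := by
    intro g hg
    have h1 : ∀ σ : J → Bool, Real.exp (δ * ∑ j, (g (j, σ j) - g (j, !σ j))) =
        ∏ j, Real.exp (δ * (g (j, σ j) - g (j, !σ j))) := by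
      intro σ
      rw [Finset.mul_sum, Real.exp_sum]
    simp_rw [h1]
    have h2 := Finset.prod_univ_sum (fun _ : J => (Finset.univ : Finset Bool))
      (fun j b => Real.exp (δ * (g (j, b) - g (j, !b))))
    rw [Fintype.piFinset_univ] at h2
    rw [← h2]
    have h3 : ∀ j ∈ (Finset.univ : Finset J),
        ∑ b, Real.exp (δ * (g (j, b) - g (j, !b))) ≤ 2 * Real.exp (δ ^ 2 / 2) := by
      intro j _
      set x := δ * (g (j, true) - g (j, false)) with hx
      have h4 : ∑ b, Real.exp (δ * (g (j, b) - g (j, !b))) = 2 * Real.cosh x := by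
        rw [Fintype.sum_bool, Real.cosh_eq, hx]
        simp only [Bool.not_true, Bool.not_false]
        have : δ * (g (j, false) - g (j, true)) = -(δ * (g (j, true) - g (j, false))) := by ring
        rw [this]; ring
      rw [h4]
      have hx2 : x ^ 2 ≤ δ ^ 2 := by
        obtain ⟨h5, h6⟩ := hG g hg (j, true)
        obtain ⟨h7, h8⟩ := hG g hg (j, false)
        rw [hx, mul_pow]
        have : (g (j, true) - g (j, false)) ^ 2 ≤ 1 := by
          rw [sq_le_one_iff_abs_le_one, abs_le]; constructor <;> linarith
        nlinarith [sq_nonneg δ]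
      have := Real.cosh_le_exp_half_sq x
      have h9 : Real.exp (x ^ 2 / 2) ≤ Real.exp (δ ^ 2 / 2) := by gcongr
      linarith
    refine (Finset.prod_le_prod (fun j _ => Finset.sum_nonneg fun b _ => (Real.exp_pos _).le)
      h3).trans ?_
    rw [Finset.prod_const, Finset.card_univ, mul_pow, ← Real.exp_nat_mul]
    apply le_of_eq
    ring_nf
  have total : ∑ σ : J → Bool, ∑ g ∈ G, Real.exp (δ * ∑ j, (g (j, σ j) - g (j, !σ j))) <
      ∑ σ : J → Bool, Real.exp (δ ^ 2 * Fintype.card J) := by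
    rw [Finset.sum_comm]
    refine (Finset.sum_le_sum mgf).trans_lt ?_
    simp only [Finset.sum_const, Finset.card_univ, Fintype.card_fun, Fintype.card_bool,
      nsmul_eq_mul, Nat.cast_pow, Nat.cast_ofNat]
    have : Real.exp (δ ^ 2 * Fintype.card J) =
        Real.exp (δ ^ 2 * Fintype.card J / 2) * Real.exp (δ ^ 2 * Fintype.card J / 2) := by
      rw [← Real.exp_add]; ring_nf
    rw [this, mul_left_comm]
    gcongr
  obtain ⟨σ, -, hσ⟩ := Finset.exists_lt_of_sum_lt total
  refine ⟨σ, fun g hg => ?_⟩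
  have h1 := (Finset.single_le_sum (f := fun g : J × Bool → ℝ =>
    Real.exp (δ * ∑ j, (g (j, σ j) - g (j, !σ j)))) (fun g _ => (Real.exp_pos _).le) hg).trans_lt hσ
  rw [Real.exp_lt_exp] at h1
  nlinarith

/-! ### Codes in which distinct words rarely agree -/

/-- The number of positions at which two words agree. -/
def agreement {α β : Type*} [Fintype α] [DecidableEq β] (f g : α → β) : ℕ :=
  (Finset.univ.filter fun i => f i = g i).card

/-- The Gilbert–Varshamov bound: over a large alphabet there are exponentially many words, any two
of which agree on at most an `η` fraction of the positions. -/
lemma exists_code {α β : Type*} [Fintype α] [Fintype β] [DecidableEq α] [DecidableEq β] [Nonempty β]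
    (η : ℝ) (hη1 : η ≤ 1) (hη : (4 : ℝ) ≤ (Fintype.card β : ℝ) ^ η) :
    ∃ C : Finset (α → β), 2 ^ Fintype.card α ≤ C.card ∧
      ∀ f ∈ C, ∀ g ∈ C, f ≠ g → (agreement f g : ℝ) ≤ η * Fintype.card α := by
  classical
  set k := Fintype.card α with hk
  set q := Fintype.card β with hq
  have hq0 : 0 < q := Fintype.card_pos
  have hq1 : (1 : ℝ) ≤ q := by exact_mod_cast hq0
  obtain ⟨C, hC, hmax⟩ := Finset.exists_max_image
    (Finset.univ.filter fun C : Finset (α → β) =>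
      ∀ f ∈ C, ∀ g ∈ C, f ≠ g → (agreement f g : ℝ) ≤ η * k) Finset.card ⟨∅, by simp⟩
  simp only [Finset.mem_filter, Finset.mem_univ, true_and] at hC hmax
  refine ⟨C, ?_, hC⟩
  -- By maximality, every word outside `C` is close to some word of `C`.
  let ball : (α → β) → Finset (α → β) := fun f =>
    insert f (Finset.univ.filter fun g => η * k < agreement f g)
  have hcover : (Finset.univ : Finset (α → β)) ⊆ C.biUnion ball := by
    intro g _
    by_contra hg
    simp only [Finset.mem_biUnion, ball, Finset.mem_insert, Finset.mem_filter, Finset.mem_univ,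
      true_and, not_exists, not_and, not_or, not_lt] at hg
    have hgC : g ∉ C := fun h => (hg g h).1 rfl
    have := hmax (insert g C) (by
      intro f hf f' hf' hne
      rw [Finset.mem_insert] at hf hf'
      rcases hf with rfl | hf <;> rcases hf' with rfl | hf'
      · exact absurd rfl hne
      · have h1 := (hg f' hf').2
        rwa [show agreement f f' = agreement f' f by simp [agreement, eq_comm]]
      · exact (hg f hf).2
      · exact hC f hf f' hf' hne)
    rw [Finset.card_insert_of_notMem hgC] at this
    omega
  have hball : ∀ f ∈ C, ((ball f).card : ℝ) ≤ 2 ^ k * (q : ℝ) ^ ((1 - η) * k) := by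
    intro f _
    have hsub : ball f ⊆ ((Finset.univ : Finset (Finset α)).filter fun A => η * k ≤ A.card).biUnion
        fun A => Fintype.piFinset fun i => if i ∈ A then {f i} else Finset.univ := by
      intro g hg
      have hle : η * k ≤ agreement f g := by
        simp only [ball, Finset.mem_insert, Finset.mem_filter, Finset.mem_univ, true_and] at hg
        rcases hg with rfl | hg
        · have : agreement g g = k := by simp [agreement, hk]
          rw [this]
          exact mul_le_of_le_one_left (Nat.cast_nonneg k) hη1
        · exact hg.le
      rw [Finset.mem_biUnion]
      refine ⟨Finset.univ.filter fun i => f i = g i, by simpa [agreement] using hle, ?_⟩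
      rw [Fintype.mem_piFinset]
      intro i
      by_cases hi : f i = g i <;> simp [hi]
    have hcardA : ∀ A ∈ (Finset.univ : Finset (Finset α)).filter fun A => η * k ≤ A.card,
        (((Fintype.piFinset fun i => if i ∈ A then {f i} else Finset.univ :
          Finset (α → β)).card : ℕ) : ℝ) ≤ (q : ℝ) ^ ((1 - η) * k) := by
      intro A hA
      rw [Finset.mem_filter] at hA
      have h1 : (Fintype.piFinset fun i => if i ∈ A then {f i} else Finset.univ :
          Finset (α → β)).card = q ^ (k - A.card) := by
        rw [Fintype.card_piFinset]
        have : ∀ i, (if i ∈ A then {f i} else Finset.univ : Finset β).card =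
            if i ∈ A then 1 else q := by
          intro i; split_ifs <;> simp [hq]
        simp_rw [this]
        rw [Finset.prod_ite, Finset.prod_const_one, one_mul, Finset.prod_const]
        congr 1
        rw [Finset.filter_not, Finset.filter_mem_eq_inter, Finset.univ_inter,
          ← Finset.compl_eq_univ_sdiff, Finset.card_compl]
      have hAk : A.card ≤ k := Finset.card_le_univ A
      rw [h1, Nat.cast_pow, ← Real.rpow_natCast, Nat.cast_sub hAk]
      exact Real.rpow_le_rpow_of_exponent_le hq1 (by linarith [hA.2])
    calc ((ball f).card : ℝ) ≤ ∑ A ∈ (Finset.univ : Finset (Finset α)).filter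
          fun A => η * k ≤ A.card, (((Fintype.piFinset fun i => if i ∈ A then {f i} else
            Finset.univ : Finset (α → β)).card : ℕ) : ℝ) := by
          exact_mod_cast (Finset.card_le_card hsub).trans Finset.card_biUnion_le
      _ ≤ ((Finset.univ : Finset (Finset α)).filter fun A => η * k ≤ A.card).card *
          (q : ℝ) ^ ((1 - η) * k) := by
          rw [← nsmul_eq_mul]
          exact Finset.sum_le_card_nsmul _ _ _ hcardA
      _ ≤ 2 ^ k * (q : ℝ) ^ ((1 - η) * k) := by
          gcongr
          have := Finset.card_filter_le (Finset.univ : Finset (Finset α)) fun A => η * k ≤ A.card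
          rw [Finset.card_univ, Fintype.card_finset] at this
          exact_mod_cast this
  have h1 : ((q : ℝ) ^ k) ≤ C.card * (2 ^ k * (q : ℝ) ^ ((1 - η) * k)) := by
    have h2 := Finset.card_le_card hcover
    have h3 : ((C.biUnion ball).card : ℝ) ≤ ∑ f ∈ C, ((ball f).card : ℝ) := by
      exact_mod_cast Finset.card_biUnion_le
    have h4 := Finset.sum_le_sum hball
    rw [Finset.sum_const, nsmul_eq_mul] at h4
    rw [Finset.card_univ, Fintype.card_fun] at h2
    calc ((q : ℝ) ^ k) ≤ ((C.biUnion ball).card : ℝ) := by exact_mod_cast h2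
      _ ≤ _ := h3.trans h4
  have hq0' : (0 : ℝ) < q := by exact_mod_cast hq0
  have h2 : ((q : ℝ) ^ k) = (q : ℝ) ^ (η * k) * (q : ℝ) ^ ((1 - η) * k) := by
    rw [← Real.rpow_natCast, ← Real.rpow_add hq0']
    ring_nf
  have h3 : (4 : ℝ) ^ k ≤ (q : ℝ) ^ (η * k) := by
    rw [Real.rpow_mul hq0'.le, Real.rpow_natCast]
    gcongr
  have hpos : (0 : ℝ) < (q : ℝ) ^ ((1 - η) * k) := Real.rpow_pos_of_pos hq0' _
  rw [h2, ← mul_assoc] at h1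
  have h4 := le_of_mul_le_mul_right h1 hpos
  have h5 : (2 : ℝ) ^ k * 2 ^ k ≤ C.card * 2 ^ k := by
    calc (2 : ℝ) ^ k * 2 ^ k = 4 ^ k := by rw [← mul_pow]; norm_num
      _ ≤ _ := h3.trans h4
  exact_mod_cast le_of_mul_le_mul_right h5 (by positivity)

/-! ### Priors whose randomness sits on one item -/

/-- A sum of independent latent coordinates in which only one coordinate matters. -/
lemma hasIndependentItems_map {n : ℕ} {ι : Type} [Fintype ι] (p : PMF ι)
    (val : ι → BundleValuation n) (i₀ : Fin n)
    (h : ∀ x x' T, i₀ ∉ T → val x T = val x' T) : HasIndependentItems (p.map val) := by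
  classical
  refine ⟨fun _ => ι, fun _ => p, fun a => val (a i₀), ?_, ?_⟩
  · intro S a a' haa
    by_cases hi : i₀ ∈ S
    · change val (a i₀) S = val (a' i₀) S
      rw [haa i₀ hi]
    · exact h _ _ _ hi
  · intro v
    have h1 := tsum_subtype {a : Fin n → ι | val (a i₀) = v} fun a => ∏ i, p (a i)
    refine Eq.trans ?_ h1.symm
    rw [PMF.map_apply, tsum_fintype, tsum_fintype]
    let G : Fin n → ι → ℝ≥0∞ := fun i x => if i = i₀ ∧ v ≠ val x then 0 else p x
    have h2 := Finset.prod_univ_sum (fun _ : Fin n => (Finset.univ : Finset ι)) G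
    rw [Fintype.piFinset_univ] at h2
    have h3 : ∀ a : Fin n → ι, Set.indicator {a : Fin n → ι | val (a i₀) = v}
        (fun a => ∏ i, p (a i)) a = ∏ i, G i (a i) := by
      intro a
      by_cases ha : val (a i₀) = v
      · rw [Set.indicator_of_mem (by exact ha)]
        refine Finset.prod_congr rfl fun i _ => ?_
        by_cases hi : i = i₀
        · subst hi; simp [G, ha]
        · simp [G, hi]
      · rw [Set.indicator_of_notMem (by exact ha)]
        refine (Finset.prod_eq_zero (Finset.mem_univ i₀) ?_).symm
        simp [G, Ne.symm ha]
    simp_rw [h3]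
    rw [← h2, ← Finset.mul_prod_erase _ _ (Finset.mem_univ i₀)]
    have h4 : ∏ i ∈ Finset.univ.erase i₀, ∑ x, G i x = 1 := by
      refine Finset.prod_eq_one fun i hi => ?_
      have hi' := Finset.ne_of_mem_erase hi
      have := p.tsum_coe
      rw [tsum_fintype] at this
      simpa [G, hi'] using this
    rw [h4, mul_one]
    refine Finset.sum_congr rfl fun x _ => ?_
    by_cases hx : v = val x <;> simp [G, hx]

/-- Expectations under the law of a random valuation. -/
lemma tsum_map_mul {n : ℕ} {ι : Type} [Fintype ι] (p : PMF ι) (val : ι → BundleValuation n)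
    (g : BundleValuation n → ℝ≥0∞) :
    ∑' v, (p.map val) v * g v = ∑ x, p x * g (val x) := by
  classical
  simp_rw [PMF.map_apply, ← ENNReal.tsum_mul_right]
  rw [ENNReal.tsum_comm, tsum_fintype]
  refine Finset.sum_congr rfl fun x _ => ?_
  rw [tsum_eq_single (val x)]
  · simp
  · intro v hv; simp [hv]

/-! ### Valuations built from a code -/

/-- A maximum over any finite nonempty family of additive clauses is XOS. -/
lemma isXOS_of_clauses {n : ℕ} {J : Type*} [Fintype J] [Nonempty J] (a : J → Fin n → ℝ≥0)
    (v : BundleValuation n) (hv : ∀ T, v T = Finset.univ.sup fun j => ∑ i ∈ T, a j i) :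
    IsXOS v := by
  classical
  let e := Fintype.equivFin J
  refine ⟨Fintype.card J, fun j => a (e.symm j), Fintype.card_pos, fun T => ?_⟩
  rw [hv T]
  refine le_antisymm (Finset.sup_le fun j _ => ?_) (Finset.sup_le fun j _ => ?_)
  · have := Finset.le_sup (f := fun j => ∑ i ∈ T, a (e.symm j) i) (Finset.mem_univ (e j))
    simpa using this
  · exact Finset.le_sup (f := fun j => ∑ i ∈ T, a j i) (Finset.mem_univ (e.symm j))

section CodeValuation

variable {n : ℕ} {Y B : Type*} [Fintype Y] [Fintype B]

/-- The best fraction of one of the sets `S y (f y)`, all of size `k`, contained in `T`. -/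
def bonus (S : Y → B → Finset (Fin n)) (k : ℕ) (f : Y → B) (T : Finset (Fin n)) : ℝ≥0 :=
  Finset.univ.sup fun y => ((T ∩ S y (f y)).card : ℝ≥0) / k

/-- The best fraction of one of the sets `S y x`, all of size `k`, contained in `T`. -/
def baseValue (S : Y → B → Finset (Fin n)) (k : ℕ) (T : Finset (Fin n)) : ℝ≥0 :=
  Finset.univ.sup fun z : Y × B => ((T ∩ S z.1 z.2).card : ℝ≥0) / k

/-- The valuation of a Buyer with level `l` and word `f`. Without the item `i₀` all types agree.
The item `i₀` is worth `l`, and in its presence only the sets `S y (f y)` chosen by the word are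
of additional value. The factor `1 / 3` normalizes values to `[0, 1]` for `l ≤ 2`. -/
def codeValuation (i₀ : Fin n) (S : Y → B → Finset (Fin n)) (k : ℕ) (l : ℝ≥0) (f : Y → B) :
    BundleValuation n := fun T =>
  (if i₀ ∈ T then l + bonus S k f T else baseValue S k T) / 3

variable {i₀ : Fin n} {S : Y → B → Finset (Fin n)} {k : ℕ}

omit [Fintype Y] [Fintype B] in
lemma card_inter_div_le_one (hS : ∀ y x, (S y x).card = k) (T : Finset (Fin n)) (y : Y) (x : B) :
    ((T ∩ S y x).card : ℝ≥0) / k ≤ 1 := by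
  refine div_le_one_of_le₀ ?_ zero_le
  rw [← hS y x]
  exact_mod_cast Finset.card_le_card Finset.inter_subset_right

omit [Fintype B] in
lemma le_bonus (f : Y → B) (T : Finset (Fin n)) (y : Y) :
    ((T ∩ S y (f y)).card : ℝ≥0) / k ≤ bonus S k f T :=
  Finset.le_sup (f := fun y => ((T ∩ S y (f y)).card : ℝ≥0) / k) (Finset.mem_univ y)

lemma le_baseValue (T : Finset (Fin n)) (z : Y × B) :
    ((T ∩ S z.1 z.2).card : ℝ≥0) / k ≤ baseValue S k T :=
  Finset.le_sup (f := fun z : Y × B => ((T ∩ S z.1 z.2).card : ℝ≥0) / k) (Finset.mem_univ z)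

omit [Fintype B] in
lemma bonus_le_one (hS : ∀ y x, (S y x).card = k) (f : Y → B) (T : Finset (Fin n)) :
    bonus S k f T ≤ 1 := Finset.sup_le fun _ _ => card_inter_div_le_one hS _ _ _

lemma baseValue_le_one (hS : ∀ y x, (S y x).card = k) (T : Finset (Fin n)) :
    baseValue S k T ≤ 1 := Finset.sup_le fun _ _ => card_inter_div_le_one hS _ _ _

omit [Fintype B] in
lemma bonus_eq_one (hk : 0 < k) (hS : ∀ y x, (S y x).card = k) (f : Y → B) {T : Finset (Fin n)}
    (y : Y) (hy : S y (f y) ⊆ T) : bonus S k f T = 1 := by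
  refine le_antisymm (bonus_le_one hS f T) ?_
  have hk' : (k : ℝ≥0) ≠ 0 := by exact_mod_cast hk.ne'
  have := Finset.le_sup (f := fun y => ((T ∩ S y (f y)).card : ℝ≥0) / k) (Finset.mem_univ y)
  simpa [Finset.inter_eq_right.2 hy, hS, hk', bonus] using this

omit [Fintype B] in
lemma bonus_singleton (hi₀ : ∀ y x, i₀ ∉ S y x) (f : Y → B) : bonus S k f {i₀} = 0 := by
  refine le_antisymm (Finset.sup_le fun y _ => ?_) zero_le
  simp [Finset.singleton_inter_of_notMem (hi₀ y (f y))]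

lemma codeValuation_singleton (hi₀ : ∀ y x, i₀ ∉ S y x) (l : ℝ≥0) (f : Y → B) :
    codeValuation i₀ S k l f {i₀} = l / 3 := by
  simp [codeValuation, bonus_singleton hi₀]

lemma codeValuation_le (hS : ∀ y x, (S y x).card = k) (l : ℝ≥0) (f : Y → B)
    (T : Finset (Fin n)) : codeValuation i₀ S k l f T ≤ (l + 1) / 3 := by
  unfold codeValuation
  gcongr
  split_ifs
  · gcongr; exact bonus_le_one hS f T
  · exact (baseValue_le_one hS T).trans le_add_self

lemma codeValuation_eq (hk : 0 < k) (hS : ∀ y x, (S y x).card = k) (l : ℝ≥0) (f : Y → B)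
    {T : Finset (Fin n)} (hT : i₀ ∈ T) (y : Y) (hy : S y (f y) ⊆ T) :
    codeValuation i₀ S k l f T = (l + 1) / 3 := by
  simp [codeValuation, hT, bonus_eq_one hk hS f y hy]

/-- The value of a bundle to the low type exceeds what the high type with the same word gains over
it by at most `1 / 3`: with the item `i₀` these are at most `2 / 3` and exactly `1 / 3`, without it
at most `1 / 3` and zero. -/
lemma two_mul_codeValuation_one_le (hS : ∀ y x, (S y x).card = k) (f : Y → B)
    (T : Finset (Fin n)) :
    2 * codeValuation i₀ S k 1 f T ≤ codeValuation i₀ S k 2 f T + 1 / 3 := by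
  have h1 := bonus_le_one hS f T
  have h2 := baseValue_le_one hS T
  unfold codeValuation
  rw [← NNReal.coe_le_coe] at *
  push_cast at *
  split_ifs <;> push_cast <;> linarith

lemma isXOS_codeValuation [Nonempty Y] (hS : ∀ y x, (S y x).card = k)
    {l : ℝ≥0} (hl : 1 ≤ l) (f : Y → B) :
    IsXOS (codeValuation i₀ S k l f) := by
  classical
  let a : (Y × B) ⊕ Y → Fin n → ℝ≥0 := Sum.elim
    (fun z i => if i ∈ S z.1 z.2 then (1 / k / 3 : ℝ≥0) else 0)
    (fun y i => (if i = i₀ then l / 3 else 0) + if i ∈ S y (f y) then (1 / k / 3 : ℝ≥0) else 0)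
  have hsum : ∀ (T U : Finset (Fin n)), ∑ i ∈ T, (if i ∈ U then (1 / k / 3 : ℝ≥0) else 0) =
      (T ∩ U).card / k / 3 := by
    intro T U
    rw [Finset.sum_ite_mem, Finset.sum_const, nsmul_eq_mul]
    ring
  have hl' : ∀ (T : Finset (Fin n)) z, ∑ i ∈ T, a (.inl z) i =
      ((T ∩ S z.1 z.2).card : ℝ≥0) / k / 3 := fun T z => hsum _ _
  have hr' : ∀ (T : Finset (Fin n)) y, ∑ i ∈ T, a (.inr y) i =
      (if i₀ ∈ T then l / 3 else 0) + ((T ∩ S y (f y)).card : ℝ≥0) / k / 3 := by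
    intro T y
    simp only [a, Sum.elim_inr]
    rw [Finset.sum_add_distrib, hsum, Finset.sum_ite_eq']
  refine isXOS_of_clauses a _ fun T => le_antisymm ?_ (Finset.sup_le fun j _ => ?_)
  · by_cases hT : i₀ ∈ T
    · obtain ⟨y, -, hy⟩ := Finset.exists_mem_eq_sup (Finset.univ : Finset Y)
        Finset.univ_nonempty fun y => ((T ∩ S y (f y)).card : ℝ≥0) / k
      refine le_trans (le_of_eq ?_) (Finset.le_sup (Finset.mem_univ (Sum.inr y)))
      rw [hr', if_pos hT, ← add_div, ← hy]
      simp [codeValuation, hT, bonus]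
    · have : Nonempty (Y × B) := ⟨(Classical.arbitrary Y, f (Classical.arbitrary Y))⟩
      obtain ⟨z, -, hz⟩ := Finset.exists_mem_eq_sup (Finset.univ : Finset (Y × B))
        Finset.univ_nonempty fun z => ((T ∩ S z.1 z.2).card : ℝ≥0) / k
      refine le_trans (le_of_eq ?_) (Finset.le_sup (Finset.mem_univ (Sum.inl z)))
      rw [hl', ← hz]
      simp [codeValuation, hT, baseValue]
  · rcases j with z | y
    · rw [hl']
      unfold codeValuation
      gcongr
      split_ifs with hT
      · exact (card_inter_div_le_one hS _ _ _).trans (hl.trans le_self_add)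
      · exact le_baseValue T z
    · rw [hr']
      unfold codeValuation
      split_ifs with hT
      · rw [← add_div]
        gcongr
        exact le_bonus f T y
      · rw [zero_add]
        gcongr
        exact le_baseValue T (y, f y)

end CodeValuation

/-! ### Protocols that offer a menu of lotteries -/

namespace ProtocolTree

variable {n : ℕ}

/-- The protocol that immediately hands out the bundle `Y` for the payment `q`. -/
def ofLeaf (Y : Finset (Fin n)) (q : ℝ≥0) : ProtocolTree n := ⟨fun _ => .leaf Y q⟩

/-- Chance tosses `b` fair coins, whose outcome determines the bundle and the payment. -/
def lottery : (b : ℕ) → ((Fin b → Bool) → Finset (Fin n) × ℝ≥0) → ProtocolTree n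
  | 0, o => ofLeaf (o Fin.elim0).1 (o Fin.elim0).2
  | b + 1, o => branch (.chance 2⁻¹ (by norm_num)) fun c => lottery b fun y => o (Fin.cons c y)

/-- The Buyer picks one of the protocols of a list, or leaves with nothing. -/
def menu : List (ProtocolTree n) → ProtocolTree n
  | [] => ofLeaf ∅ 0
  | T :: L => branch .buyer fun b => if b then T else menu L

lemma leafExpectation_lottery (b : ℕ) (o : (Fin b → Bool) → Finset (Fin n) × ℝ≥0)
    (s : BuyerStrategy) (f : Finset (Fin n) → ℝ≥0 → ℝ≥0) :
    (lottery b o).leafExpectation s (fun _ Y q => (f Y q : ℝ≥0∞)) =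
      ((∑ y, f (o y).1 (o y).2) / 2 ^ b : ℝ≥0) := by
  induction b generalizing s with
  | zero =>
    rw [leafExpectation_of_leaf (Y := (o Fin.elim0).1) (q := (o Fin.elim0).2) _ _ rfl]
    rw [Fintype.sum_unique, pow_zero, div_one]
    congr
  | succ b ih =>
    rw [leafExpectation_of_chance (p := 2⁻¹) (hp := by norm_num) _ _ rfl]
    simp only [lottery, child_branch, ih]
    rw [← ENNReal.coe_mul, ← ENNReal.coe_mul, ← ENNReal.coe_add, ENNReal.coe_inj]
    have h1 : ∑ y : Fin (b + 1) → Bool, f (o y).1 (o y).2 =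
        ∑ c : Bool, ∑ y : Fin b → Bool, f (o (Fin.cons c y)).1 (o (Fin.cons c y)).2 := by
      rw [← Fintype.sum_prod_type', ← (Fin.consEquiv fun _ => Bool).sum_comp]
      rfl
    have h2 : (1 - 2⁻¹ : ℝ≥0) = 2⁻¹ := by
      rw [tsub_eq_iff_eq_add_of_le (by norm_num)]; norm_num
    rw [h1, Fintype.sum_bool, h2, pow_succ]
    field_simp

/-- Whatever the Buyer does in a menu, she ends up with one of the options. -/
lemma leafExpectation_menu (L : List (ProtocolTree n)) (s : BuyerStrategy) :
    (∀ f : Finset (Fin n) → ℝ≥0 → ℝ≥0∞, (menu L).leafExpectation s (fun _ => f) = f ∅ 0) ∨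
    ∃ T ∈ L, ∃ s', ∀ f : Finset (Fin n) → ℝ≥0 → ℝ≥0∞,
      (menu L).leafExpectation s (fun _ => f) = T.leafExpectation s' fun _ => f := by
  induction L generalizing s with
  | nil => exact Or.inl fun f => leafExpectation_of_leaf (Y := ∅) (q := 0) _ _ rfl _
  | cons T L ih =>
    have h := fun f : Finset (Fin n) → ℝ≥0 → ℝ≥0∞ =>
      leafExpectation_of_buyer (menu (T :: L)) s rfl fun _ => f
    simp only [h]
    cases hs : s []
    · simp only [menu, child_branch, Bool.false_eq_true, if_false]
      rcases ih (s.child false) with h1 | ⟨T', hT', s', h1⟩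
      · exact Or.inl h1
      · exact Or.inr ⟨T', List.mem_cons_of_mem _ hT', s', h1⟩
    · exact Or.inr ⟨T, List.mem_cons_self, s.child true, fun f => by simp [menu]⟩

/-- The Buyer can obtain every option of a menu. -/
lemma exists_strategy_menu {L : List (ProtocolTree n)} {T : ProtocolTree n} (hT : T ∈ L)
    (s' : BuyerStrategy) : ∃ s, ∀ f : Finset (Fin n) → ℝ≥0 → ℝ≥0∞,
      (menu L).leafExpectation s (fun _ => f) = T.leafExpectation s' fun _ => f := by
  induction L with
  | nil => simp at hT
  | cons T' L ih =>
    by_cases hTT : T = T'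
    · subst hTT
      refine ⟨.branch true fun _ => s', fun f => ?_⟩
      rw [leafExpectation_of_buyer (menu (T :: L)) _ rfl]
      simp [menu]
    · obtain ⟨s, hs⟩ := ih (by simpa [hTT] using hT)
      refine ⟨.branch false fun _ => s, fun f => ?_⟩
      rw [leafExpectation_of_buyer (menu (T' :: L)) _ rfl]
      simpa [menu] using hs f

lemma exists_strategy_menu_exit (L : List (ProtocolTree n)) : ∃ s,
    ∀ f : Finset (Fin n) → ℝ≥0 → ℝ≥0∞, (menu L).leafExpectation s (fun _ => f) = f ∅ 0 := by
  induction L with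
  | nil => exact ⟨fun _ => true, fun f => leafExpectation_of_leaf (Y := ∅) (q := 0) _ _ rfl _⟩
  | cons T L ih =>
    obtain ⟨s, hs⟩ := ih
    refine ⟨.branch false fun _ => s, fun f => ?_⟩
    rw [leafExpectation_of_buyer (menu (T :: L)) _ rfl]
    simpa [menu] using hs f

lemma isIR_menu (L : List (ProtocolTree n)) : (menu L).IsIR := by
  classical
  obtain ⟨s, hs⟩ := exists_strategy_menu_exit L
  refine ⟨s, (hs fun _ q => (q : ℝ≥0∞)).trans ENNReal.coe_zero, fun w Y q hw hr => ?_⟩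
  have h1 := hs fun Y _ => if Y = ∅ then 0 else 1
  rw [if_pos rfl] at h1
  have h2 := ENNReal.tsum_eq_zero.1 h1 w
  rw [hw] at h2
  by_contra hY
  simp [hY, hr] at h2

end ProtocolTree

/-- The revenue of posting a menu of lotteries, one option `o x` for every type `x`, in which every
type prefers its own option to the others and to leaving, is a lower bound for the optimal
revenue. -/
lemma le_optimalRevenue_of_lotteries {n b : ℕ} {ι : Type} [Fintype ι] (p : PMF ι)
    (val : ι → BundleValuation n) (o : ι → (Fin b → Bool) → Finset (Fin n) × ℝ≥0)
    (hIR : ∀ x, (∑ y, (o x y).2) + (2 ^ b : ℝ≥0) * val x ∅ ≤ ∑ y, val x (o x y).1)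
    (hIC : ∀ x z, ∑ y, val x (o z y).1 + ∑ y, (o x y).2 ≤
      ∑ y, val x (o x y).1 + ∑ y, (o z y).2)
    (hpay : ∀ x z, val x = val z → ∑ y, (o x y).2 = ∑ y, (o z y).2) :
    ∑ x, p x * (((∑ y, (o x y).2) / 2 ^ b : ℝ≥0) : ℝ≥0∞) ≤ optimalRevenue (p.map val) := by
  classical
  set L : List (ProtocolTree n) := Finset.univ.toList.map fun x => ProtocolTree.lottery b (o x)
    with hL
  have hmem : ∀ x, ProtocolTree.lottery b (o x) ∈ L := fun x =>
    List.mem_map.2 ⟨x, by simp, rfl⟩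
  choose S hS using fun x => ProtocolTree.exists_strategy_menu (hmem x) fun _ => true
  -- `val` need not be injective; the option of any type with the given valuation is optimal
  let sug : BundleValuation n → BuyerStrategy := fun v =>
    if h : ∃ x, val x = v then S h.choose else fun _ => true
  have hsug : ∀ x, ∃ x', val x' = val x ∧ sug (val x) = S x' := fun x => by
    have h : ∃ x', val x' = val x := ⟨x, rfl⟩
    exact ⟨h.choose, h.choose_spec, by simp only [sug, dif_pos h]⟩
  let M : AuctionProtocol n := { ProtocolTree.menu L with suggested := sug }
  have hSf : ∀ x (f : Finset (Fin n) → ℝ≥0 → ℝ≥0),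
      (ProtocolTree.menu L).leafExpectation (S x) (fun _ Y q => (f Y q : ℝ≥0∞)) =
        ((∑ y, f (o x y).1 (o x y).2) / 2 ^ b : ℝ≥0) := fun x f => by
    rw [hS x fun Y q => (f Y q : ℝ≥0∞), ProtocolTree.leafExpectation_lottery]
  have hpow : (2 ^ b : ℝ≥0) ≠ 0 := by positivity
  have hM : M.IsIC (p.map val) := by
    refine ⟨fun s => ?_, ProtocolTree.isIR_menu L, fun v hv s => ?_⟩
    · rcases ProtocolTree.leafExpectation_menu L s with h | ⟨T, hT, s', h⟩
      · exact h fun _ _ => 1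
      · obtain ⟨x, -, rfl⟩ := List.mem_map.1 hT
        refine (h fun _ _ => 1).trans ?_
        have := ProtocolTree.leafExpectation_lottery b (o x) s' fun _ _ => 1
        simp only [ENNReal.coe_one] at this
        rw [this]
        simp
    · obtain ⟨x₀, -, rfl⟩ := (PMF.mem_support_map_iff _ _ _).1 hv
      obtain ⟨x, hx, hsx⟩ := hsug x₀
      change (ProtocolTree.menu L).leafExpectation s (fun _ Y _ => (val x₀ Y : ℝ≥0∞)) +
          (ProtocolTree.menu L).leafExpectation (sug (val x₀)) (fun _ _ q => (q : ℝ≥0∞)) ≤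
        (ProtocolTree.menu L).leafExpectation (sug (val x₀)) (fun _ Y _ => (val x₀ Y : ℝ≥0∞)) +
          (ProtocolTree.menu L).leafExpectation s (fun _ _ q => (q : ℝ≥0∞)) + (0 : ℝ≥0)
      rw [← hx] at *
      rw [hsx, hSf x fun _ q => q, hSf x fun Y _ => val x Y, ENNReal.coe_zero, add_zero]
      rcases ProtocolTree.leafExpectation_menu L s with h | ⟨T, hT, s', h⟩
      · rw [h fun _ q => (q : ℝ≥0∞), h fun Y _ => (val x Y : ℝ≥0∞), ← ENNReal.coe_add,
          ← ENNReal.coe_add, ENNReal.coe_le_coe, add_zero, add_comm]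
        rw [div_add' _ _ _ hpow]
        gcongr
        rw [mul_comm (val x ∅)]
        exact hIR x
      · obtain ⟨z, -, rfl⟩ := List.mem_map.1 hT
        rw [h fun _ q => (q : ℝ≥0∞), h fun Y _ => (val x Y : ℝ≥0∞),
          ProtocolTree.leafExpectation_lottery b (o z) s' fun _ q => q,
          ProtocolTree.leafExpectation_lottery b (o z) s' fun Y _ => val x Y, ← ENNReal.coe_add,
          ← ENNReal.coe_add, ENNReal.coe_le_coe, ← add_div, ← add_div]
        exact div_le_div_of_nonneg_right (hIC x z) zero_le
  refine le_trans (le_of_eq ?_) (le_iSup₂ (f := fun (M : AuctionProtocol n) _ =>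
    M.revenue (p.map val)) M hM)
  rw [AuctionProtocol.revenue, tsum_map_mul]
  refine Finset.sum_congr rfl fun x _ => ?_
  obtain ⟨x', hx', hsx⟩ := hsug x
  change _ = p x * (ProtocolTree.menu L).leafExpectation (sug (val x)) (fun _ _ q => (q : ℝ≥0∞))
  rw [hsx, hSf x' fun _ q => q, hpay x' x hx']


section CodePrior

variable {n : ℕ} {i₀ : Fin n} {b : ℕ} {B : Type} [Fintype B] [DecidableEq B]
  {S : (Fin b → Bool) → B → Finset (Fin n)} {k : ℕ}

omit [Fintype B] in
/-- A word obtains little bonus, on average, from the sets chosen by a word that rarely agrees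
with it. -/
lemma sum_bonus_le (hk : 0 < k) (hS : ∀ y x, (S y x).card = k) (hi₀ : ∀ y x, i₀ ∉ S y x)
    {η : ℝ≥0} (hη : ∀ y x y' x', (y, x) ≠ (y', x') → ((S y x ∩ S y' x').card : ℝ≥0) ≤ η * k)
    (f g : (Fin b → Bool) → B) (hfg : (agreement f g : ℝ≥0) ≤ η * 2 ^ b) :
    ∑ y, bonus S k f (insert i₀ (S y (g y))) ≤ 2 * η * 2 ^ b := by
  classical
  have hk' : (0 : ℝ≥0) < k := by exact_mod_cast hk
  have h1 : ∀ y, bonus S k f (insert i₀ (S y (g y))) ≤ (if f y = g y then 1 else 0) + η := by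
    intro y
    split_ifs with h
    · exact (bonus_le_one hS f _).trans le_self_add
    · rw [zero_add]
      refine Finset.sup_le fun y' _ => ?_
      rw [Finset.insert_inter_of_notMem (hi₀ _ _), div_le_iff₀ hk']
      refine hη y (g y) y' (f y') fun heq => h ?_
      obtain ⟨rfl, h2⟩ := Prod.mk.inj heq
      exact h2.symm
  refine (Finset.sum_le_sum fun y _ => h1 y).trans ?_
  rw [Finset.sum_add_distrib, Finset.sum_boole, Finset.sum_const, Finset.card_univ, nsmul_eq_mul]
  simp only [Fintype.card_fun, Fintype.card_bool, Fintype.card_fin, Nat.cast_pow, Nat.cast_ofNat]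
  calc _ ≤ η * 2 ^ b + 2 ^ b * η := by gcongr; exact hfg
    _ = _ := by ring

/-- The value of the item `i₀`, in units of `1 / 3`: it is `1` for the low types, tagged `true`,
and `2` for the high types, tagged `false`. -/
def levelOf (t : Bool) : ℝ≥0 := if t then 1 else 2

/-- Selling to each low type the uniform lottery over its favourite bundles, and all items to the
high types, extracts almost the full surplus. -/
lemma le_optimalRevenue_codeValuation {J : Type} [Fintype J] [Nonempty J] (hk : 0 < k)
    (hS : ∀ y x, (S y x).card = k) (hi₀ : ∀ y x, i₀ ∉ S y x) {η : ℝ≥0} (hη2 : η ≤ 1 / 2)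
    (hη : ∀ y x y' x', (y, x) ≠ (y', x') → ((S y x ∩ S y' x').card : ℝ≥0) ≤ η * k)
    (f : J × Bool → (Fin b → Bool) → B)
    (hf : ∀ j j', (agreement (f (j, false)) (f (j', true)) : ℝ≥0) ≤ η * 2 ^ b) :
    ENNReal.ofReal ((5 - 2 * η) / 6) ≤ optimalRevenue ((PMF.uniformOfFintype (J × Bool)).map
      fun x => codeValuation i₀ S k (levelOf x.2) (f x)) := by
  classical
  set val : J × Bool → BundleValuation n := fun x => codeValuation i₀ S k (levelOf x.2) (f x)
    with hval
  have hηr : (η : ℝ) ≤ 1 / 2 := by exact_mod_cast hη2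
  -- the high types get a discount that makes up for the overlaps of the words and of the bundles
  let hiPay : ℝ≥0 := ⟨(3 - 2 * η) / 3, by linarith⟩
  have hhi : (hiPay : ℝ) = (3 - 2 * η) / 3 := rfl
  let o : J × Bool → (Fin b → Bool) → Finset (Fin n) × ℝ≥0 := fun x y =>
    if x.2 then (insert i₀ (S y (f x y)), 2 / 3) else (Finset.univ, hiPay)
  have sumPay : ∀ x, ∑ y, (o x y).2 = 2 ^ b * if x.2 then 2 / 3 else hiPay := by
    rintro ⟨j, _ | _⟩ <;> simp [o]
  have hempty : ∀ x, val x ∅ = 0 := fun x => by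
    refine le_antisymm ?_ zero_le
    simp [hval, codeValuation, baseValue]
  have hlow : ∀ j T, val (j, true) T ≤ 2 / 3 := fun j T =>
    (codeValuation_le hS _ _ T).trans (by norm_num [levelOf])
  have hhigh : ∀ j T, val (j, false) T ≤ 1 := fun j T =>
    (codeValuation_le hS _ _ T).trans (by norm_num [levelOf])
  have hlow' : ∀ j y, val (j, true) (insert i₀ (S y (f (j, true) y))) = 2 / 3 := fun j y => by
    rw [hval]
    simp only
    rw [codeValuation_eq hk hS _ _ (Finset.mem_insert_self _ _) y (Finset.subset_insert _ _)]
    norm_num [levelOf]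
  have hhigh' : ∀ j, val (j, false) Finset.univ = 1 := fun j => by
    rw [hval]
    simp only
    rw [codeValuation_eq hk hS _ _ (Finset.mem_univ _) (fun _ => false) (Finset.subset_univ _)]
    norm_num [levelOf]
  have ownLow : ∀ j, ∑ y, val (j, true) (o (j, true) y).1 = 2 ^ b * (2 / 3) := fun j => by
    simp [o, hlow']
  have ownHigh : ∀ j, ∑ y, val (j, false) (o (j, false) y).1 = 2 ^ b := fun j => by
    simp [o, hhigh']
  have leLow : ∀ j z, ∑ y, val (j, true) (o z y).1 ≤ 2 ^ b * (2 / 3) := fun j z => by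
    refine (Finset.sum_le_sum fun y _ => hlow j _).trans ?_
    simp
  have leHigh : ∀ j z, ∑ y, val (j, false) (o z y).1 ≤ 2 ^ b := fun j z => by
    refine (Finset.sum_le_sum fun y _ => hhigh j _).trans ?_
    simp
  have cross : ∀ j j', ∑ y, val (j, false) (o (j', true) y).1 ≤ 2 ^ b * (2 / 3 + 2 * η / 3) := by
    intro j j'
    have h1 := sum_bonus_le hk hS hi₀ hη (f (j, false)) (f (j', true)) (hf j j')
    have h2 : ∑ y, val (j, false) (o (j', true) y).1 =
        (2 ^ b * 2 + ∑ y, bonus S k (f (j, false)) (insert i₀ (S y (f (j', true) y)))) / 3 := by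
      simp [hval, o, codeValuation, levelOf, ← Finset.sum_div, Finset.sum_add_distrib]
    rw [h2]
    calc _ ≤ (2 ^ b * 2 + 2 * η * 2 ^ b) / 3 := by gcongr
      _ = _ := by ring
  have hpowr : (0 : ℝ) < 2 ^ b := by positivity
  have key := le_optimalRevenue_of_lotteries (PMF.uniformOfFintype (J × Bool)) val o ?_ ?_ ?_
  · refine le_trans (le_of_eq ?_) key
    have h2 : ∀ x : J × Bool, (∑ y, (o x y).2) / 2 ^ b = if x.2 then 2 / 3 else hiPay := by
      intro x
      rw [sumPay, mul_div_cancel_left₀ _ (by positivity)]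
    simp_rw [h2]
    rw [Fintype.sum_prod_type]
    simp only [PMF.uniformOfFintype_apply, Fintype.sum_bool, Finset.sum_const, Finset.card_univ,
      nsmul_eq_mul, if_true, Bool.false_eq_true, if_false, Fintype.card_prod, Fintype.card_bool]
    have hJ : (Fintype.card J : ℝ≥0) ≠ 0 := by
      exact_mod_cast Fintype.card_ne_zero
    have h3 : (((Fintype.card J * 2 : ℕ) : ℝ≥0∞))⁻¹ =
        (((Fintype.card J * 2 : ℝ≥0)⁻¹ : ℝ≥0) : ℝ≥0∞) := by
      rw [ENNReal.coe_inv (by positivity)]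
      push_cast
      rfl
    rw [h3]
    have h4 : ((Fintype.card J : ℕ) : ℝ≥0∞) = ((Fintype.card J : ℝ≥0) : ℝ≥0∞) := by simp
    rw [h4, ← ENNReal.coe_mul, ← ENNReal.coe_mul, ← ENNReal.coe_add, ← ENNReal.coe_mul,
      ENNReal.ofReal, ENNReal.coe_inj]
    have h5 : ((5 - 2 * (η : ℝ)) / 6).toNNReal = (2 / 3 + hiPay) / 2 := by
      rw [Real.toNNReal_eq_iff_eq_coe (by
        intro h0
        have := congrArg NNReal.toReal h0
        push_cast at this
        rw [hhi] at this
        linarith)]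
      push_cast
      rw [hhi]
      ring
    rw [h5]
    field_simp
  · intro x
    rw [hempty, mul_zero, add_zero, sumPay]
    obtain ⟨j, _ | _⟩ := x
    · rw [ownHigh, ← NNReal.coe_le_coe]
      rw [if_neg Bool.false_ne_true]
      push_cast
      rw [hhi]
      have := η.2
      exact mul_le_of_le_one_right hpowr.le (by linarith)
    · rw [ownLow]
      simp
  · intro x z
    rw [sumPay, sumPay]
    obtain ⟨j, _ | _⟩ := x
    · obtain ⟨j', _ | _⟩ := z
      · rw [ownHigh]
        gcongr
        exact leHigh _ _
      · have h1 := cross j j'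
        rw [ownHigh]
        rw [← NNReal.coe_le_coe] at h1 ⊢
        simp only [Bool.false_eq_true, if_false, if_true]
        push_cast at h1 ⊢
        rw [hhi]
        linarith
    · have h1 := leLow j z
      rw [ownLow]
      obtain ⟨j', _ | _⟩ := z
      · rw [← NNReal.coe_le_coe] at h1 ⊢
        simp only [Bool.false_eq_true, if_false, if_true]
        push_cast at h1 ⊢
        rw [hhi]
        have : (2 : ℝ) ^ b * (2 / 3) ≤ 2 ^ b * ((3 - 2 * η) / 3) := by gcongr; linarith
        linarith
      · gcongr
  · intro x z hxz
    have h1 := congrFun hxz {i₀}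
    simp only [hval] at h1
    rw [codeValuation_singleton hi₀, codeValuation_singleton hi₀] at h1
    rw [sumPay, sumPay]
    obtain ⟨j, _ | _⟩ := x <;> obtain ⟨j', _ | _⟩ := z <;> first | rfl | (norm_num [levelOf] at h1)

end CodePrior

/-! ### Short protocols cannot separate the two levels -/

namespace AuctionProtocol

variable {n : ℕ} (M : AuctionProtocol n) {D : PMF (BundleValuation n)}

/-- A suggested strategy never has infinite expected payment: leaving with nothing is better. -/
lemma expectedPayment_suggested_le {ε : ℝ≥0} (hM : M.IsAlmostIC D ε) {v : BundleValuation n}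
    (hv : v ∈ D.support) :
    M.expectedPayment (M.suggested v) ≤ M.expectedValue v (M.suggested v) + ε := by
  obtain ⟨s, hs, -⟩ := hM.2.1
  have := hM.2.2 v hv s
  rw [hs, add_zero] at this
  exact le_add_self.trans this

end AuctionProtocol

/-- Truncation of real numbers to the interval `[0, 1]`. -/
def clampUnit (x : ℝ) : ℝ := max 0 (min x 1)

lemma clampUnit_mem (x : ℝ) : 0 ≤ clampUnit x ∧ clampUnit x ≤ 1 :=
  ⟨le_max_left _ _, max_le zero_le_one (min_le_right _ _)⟩

/-- The revenue bound. The pair of types `j` consists of a low type `val (j, true)` and a high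
type `val (j, false)`. If the words of the two types are indistinguishable for truncated
utilities, the high type does as well as it would if it imitated a low type with its own word;
then the two payments sum to at most `4 / 3`, up to small errors. -/
lemma revenue_le_of_fooled {n : ℕ} {J : Type} [Fintype J] [Nonempty J]
    (val h : J × Bool → BundleValuation n) (σ : J → Bool)
    (hval : ∀ x Y, val x Y ≤ 1) (hh : ∀ x Y, h x Y ≤ 1)
    (hlow : ∀ j Y, 2 * val (j, true) Y ≤ h (j, σ j) Y + 1 / 3)
    (hhigh : ∀ j, val (j, false) = h (j, !σ j))
    {R K : ℕ} (hR : 0 < R) (hK : 0 < K) {δ : ℝ} (he : 2 ^ K * (2 / R : ℝ) < 1)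
    (hσ : ∀ g ∈ utilityClass h R K,
      ∑ j, (clampUnit (g (j, σ j)) - clampUnit (g (j, !σ j))) ≤ δ * Fintype.card J)
    (M : AuctionProtocol n) {ε : ℝ≥0}
    (hM : M.IsAlmostIC ((PMF.uniformOfFintype (J × Bool)).map val) ε) {C : ℝ} (hC : 0 ≤ C)
    (hcomm : M.exAnteCommunication ((PMF.uniformOfFintype (J × Bool)).map val) ≤
      ENNReal.ofReal C) :
    M.revenue ((PMF.uniformOfFintype (J × Bool)).map val) ≤
      ENNReal.ofReal (2 / 3 + (δ + 2 * (2 ^ K * (2 / R)) + 3 * ε) / 2 + C / K) := by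
  classical
  set D := (PMF.uniformOfFintype (J × Bool)).map val with hD
  set e : ℝ := 2 ^ K * (2 / R) with hedef
  set N : ℕ := Fintype.card J with hN
  have hN0 : (0 : ℝ) < N := by exact_mod_cast Fintype.card_pos
  have hK0 : (0 : ℝ) < K := by exact_mod_cast hK
  have hsupp : ∀ x, val x ∈ D.support := fun x =>
    (PMF.mem_support_map_iff _ _ _).2 ⟨x, by simp, rfl⟩
  have hfin := hM.1
  set sg : J × Bool → BuyerStrategy := fun x => M.suggested (val x) with hsg
  have hEtop : ∀ v : BundleValuation n, (∀ Y, v Y ≤ 1) → ∀ s, M.expectedValue v s ≠ ∞ :=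
    fun v hv s => ne_top_of_le_ne_top (by simp) (M.expectedValue_le_one s hfin v hv)
  have hPtop : ∀ x, M.expectedPayment (sg x) ≠ ∞ := fun x =>
    ne_top_of_le_ne_top (ENNReal.add_ne_top.2 ⟨hEtop _ (hval x) _, by simp⟩)
      (M.expectedPayment_suggested_le hM (hsupp x))
  have hE1 : ∀ v : BundleValuation n, (∀ Y, v Y ≤ 1) → ∀ s, (M.expectedValue v s).toReal ≤ 1 :=
    fun v hv s => by
      simpa using ENNReal.toReal_mono (by simp) (M.expectedValue_le_one s hfin v hv)
  have hPE : ∀ x, (M.expectedPayment (sg x)).toReal ≤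
      (M.expectedValue (val x) (sg x)).toReal + ε := fun x => by
    have := ENNReal.toReal_mono (ENNReal.add_ne_top.2 ⟨hEtop _ (hval x) _, by simp⟩)
      (M.expectedPayment_suggested_le hM (hsupp x))
    rwa [ENNReal.toReal_add (hEtop _ (hval x) _) (by simp), ENNReal.coe_toReal] at this
  -- the two expectations over the prior, as averages over the index set
  have hp : ∀ x : J × Bool, PMF.uniformOfFintype (J × Bool) x = ENNReal.ofReal (1 / (2 * N)) := by
    intro x
    rw [PMF.uniformOfFintype_apply, Fintype.card_prod, Fintype.card_bool, one_div,
      ENNReal.ofReal_inv_of_pos (by positivity), mul_comm,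
      ENNReal.ofReal_mul (by positivity), ENNReal.ofReal_natCast]
    simp [hN]
  have havg : ∀ g : BundleValuation n → ℝ≥0∞,
      ∑' v, D v * g v = ENNReal.ofReal (1 / (2 * N)) * ∑ x, g (val x) := fun g => by
    rw [hD, tsum_map_mul, Finset.mul_sum]
    simp_rw [hp]
  have hposN : 0 < 1 / (2 * (N : ℝ)) := by positivity
  unfold AuctionProtocol.exAnteCommunication at hcomm
  rw [havg] at hcomm
  have hdtop : ∀ x, M.expectedDepth (sg x) ≠ ∞ := by
    intro x hx
    have h1 : ∑ x, M.expectedDepth (sg x) = ∞ :=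
      ENNReal.sum_eq_top.2 ⟨x, Finset.mem_univ _, hx⟩
    simp only [hsg] at h1
    rw [h1, ENNReal.mul_top (ENNReal.ofReal_pos.2 hposN).ne'] at hcomm
    simp at hcomm
  have hdsum : ∑ x, (M.expectedDepth (sg x)).toReal ≤ 2 * N * C := by
    have h1 := ENNReal.toReal_mono (by simp) hcomm
    rw [ENNReal.toReal_mul, ENNReal.toReal_ofReal hposN.le, ENNReal.toReal_ofReal hC,
      ENNReal.toReal_sum fun x _ => hdtop x, one_div, inv_mul_le_iff₀ (by positivity)] at h1
    exact h1
  obtain ⟨g, hg, -, hgl, hgu⟩ := M.exists_mem_utilityClass_approx h hh R hR K 1 le_rfl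
  simp only [ENNReal.coe_one, one_mul, NNReal.coe_one, ← hedef] at hgl hgu
  -- The strategy of a low type is one of those that a high type with the same word may imitate.
  have low : ∀ j, (M.expectedPayment (sg (j, true))).toReal ≤ clampUnit (g (j, σ j)) + e + 1 / 3 +
      2 * ε + (M.expectedDepth (sg (j, true))).toReal / K := by
    intro j
    set s := sg (j, true)
    have hAtop : M.truncatedValue (h (j, σ j)) K s ≠ ∞ :=
      ne_top_of_le_ne_top (by simp) (M.truncatedValue_le_one s _ (hh _) K)
    have hA1 : (M.truncatedValue (h (j, σ j)) K s).toReal ≤ 1 := by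
      simpa using ENNReal.toReal_mono (by simp) (M.truncatedValue_le_one s _ (hh (j, σ j)) K)
    have hP0 : 0 ≤ (M.expectedPayment s).toReal := ENNReal.toReal_nonneg
    have h1 := hgl (j, σ j) s (hPtop _)
    have h2 : (M.truncatedValue (h (j, σ j)) K s).toReal - (M.expectedPayment s).toReal ≤
        clampUnit (g (j, σ j)) + e := by
      have he0 : 0 ≤ e := by positivity
      rcases le_total (g (j, σ j)) 1 with h3 | h3
      · have : g (j, σ j) ≤ clampUnit (g (j, σ j)) := by
          rw [clampUnit, min_eq_left h3]; exact le_max_right _ _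
        linarith
      · have : 1 ≤ clampUnit (g (j, σ j)) := by
          rw [clampUnit, min_eq_right h3]; exact le_max_right _ _
        linarith
    have h3 : (M.expectedValue (h (j, σ j)) s).toReal ≤
        (M.truncatedValue (h (j, σ j)) K s).toReal + (M.expectedDepth s).toReal / K := by
      have h4 := ENNReal.toReal_mono (ENNReal.add_ne_top.2 ⟨ENNReal.mul_ne_top (by simp) hAtop,
        hdtop _⟩) (M.mul_expectedValue_le s (h (j, σ j)) (hh _) K)
      rw [ENNReal.toReal_add (ENNReal.mul_ne_top (by simp) hAtop) (hdtop _), ENNReal.toReal_mul,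
        ENNReal.toReal_mul, ENNReal.toReal_natCast] at h4
      rw [← sub_le_iff_le_add', le_div_iff₀ hK0]
      linarith
    have h5 : 2 * (M.expectedValue (val (j, true)) s).toReal ≤
        (M.expectedValue (h (j, σ j)) s).toReal + 1 / 3 := by
      have h6 : 2 * M.expectedValue (val (j, true)) s ≤
          M.expectedValue (h (j, σ j)) s + ((1 / 3 : ℝ≥0) : ℝ≥0∞) * M.terminationProb s := by
        unfold ProtocolTree.expectedValue ProtocolTree.terminationProb
        rw [← ProtocolTree.leafExpectation_const_mul, ← ProtocolTree.leafExpectation_const_mul,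
          ← ProtocolTree.leafExpectation_add]
        refine M.leafExpectation_mono s fun w Y q => ?_
        rw [mul_one]
        exact_mod_cast hlow j Y
      rw [hfin s, mul_one] at h6
      have h7 := ENNReal.toReal_mono (ENNReal.add_ne_top.2
        ⟨hEtop _ (hh (j, σ j)) s, by simp⟩) h6
      rw [ENNReal.toReal_add (hEtop _ (hh (j, σ j)) s) (by simp), ENNReal.toReal_mul] at h7
      simpa using h7
    have h6 := hPE (j, true)
    change (M.expectedPayment s).toReal ≤ (M.expectedValue (val (j, true)) s).toReal + ε at h6
    linarith
  -- If `g` is positive, the costs in it were not capped, and some strategy attains it.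
  have high : ∀ j, (M.expectedPayment (sg (j, false))).toReal ≤
      1 - clampUnit (g (j, !σ j)) + e + ε := by
    intro j
    have hE := hE1 _ (hval (j, false)) (sg (j, false))
    have he0 : 0 ≤ e := by positivity
    rcases le_or_gt (g (j, !σ j)) 0 with h0 | h0
    · have h1 : clampUnit (g (j, !σ j)) = 0 := by
        rw [clampUnit, min_eq_left (by linarith), max_eq_left h0]
      have := hPE (j, false)
      rw [h1]
      linarith
    · have h1 : clampUnit (g (j, !σ j)) ≤ g (j, !σ j) := max_le h0.le (min_le_left _ _)
      rcases hgu (j, !σ j) with h2 | ⟨s, hs, h2⟩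
      · linarith
      · have h3 := hM.2.2 _ (hsupp (j, false)) s
        have h4 := ENNReal.toReal_mono (ENNReal.add_ne_top.2 ⟨ENNReal.add_ne_top.2
          ⟨hEtop _ (hval (j, false)) _, hs⟩, by simp⟩) h3
        rw [ENNReal.toReal_add (hEtop _ (hval (j, false)) _) (hPtop (j, false)),
          ENNReal.toReal_add (ENNReal.add_ne_top.2 ⟨hEtop _ (hval (j, false)) _, hs⟩) (by simp),
          ENNReal.toReal_add (hEtop _ (hval (j, false)) _) hs, ENNReal.coe_toReal] at h4
        have h5 := ENNReal.toReal_mono (hEtop _ (hval (j, false)) s)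
          (M.truncatedValue_le_expectedValue s (val (j, false)) K)
        rw [← hhigh j] at h2
        change _ ≤ (M.expectedValue (val (j, false)) (sg (j, false))).toReal + _ + _ at h4
        change _ + (M.expectedPayment (sg (j, false))).toReal ≤ _ at h4
        linarith
  unfold AuctionProtocol.revenue
  rw [havg]
  have hsum : ∑ x, M.expectedPayment (M.suggested (val x)) =
      ENNReal.ofReal (∑ x, (M.expectedPayment (sg x)).toReal) := by
    rw [ENNReal.ofReal_sum_of_nonneg fun _ _ => ENNReal.toReal_nonneg]
    exact Finset.sum_congr rfl fun x _ => (ENNReal.ofReal_toReal (hPtop x)).symm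
  rw [hsum, ← ENNReal.ofReal_mul hposN.le]
  refine ENNReal.ofReal_le_ofReal ?_
  rw [one_div, inv_mul_le_iff₀ (by positivity), Fintype.sum_prod_type]
  simp only [Fintype.sum_bool]
  have hdlow : ∑ j, (M.expectedDepth (sg (j, true))).toReal ≤ 2 * N * C := by
    refine le_trans ?_ hdsum
    rw [Fintype.sum_prod_type]
    refine Finset.sum_le_sum fun j _ => ?_
    rw [Fintype.sum_bool]
    have : 0 ≤ (M.expectedDepth (sg (j, false))).toReal := ENNReal.toReal_nonneg
    linarith
  calc ∑ j, ((M.expectedPayment (sg (j, true))).toReal + (M.expectedPayment (sg (j, false))).toReal)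
      ≤ ∑ j, ((clampUnit (g (j, σ j)) - clampUnit (g (j, !σ j))) + (4 / 3 + 2 * e + 3 * ε) +
          (M.expectedDepth (sg (j, true))).toReal / K) :=
        Finset.sum_le_sum fun j _ => by linarith [low j, high j]
    _ = ∑ j, (clampUnit (g (j, σ j)) - clampUnit (g (j, !σ j))) + N * (4 / 3 + 2 * e + 3 * ε) +
          (∑ j, (M.expectedDepth (sg (j, true))).toReal) / K := by
        rw [Finset.sum_add_distrib, Finset.sum_add_distrib, Finset.sum_const, Finset.card_univ,
          nsmul_eq_mul, Finset.sum_div]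
    _ ≤ δ * N + N * (4 / 3 + 2 * e + 3 * ε) + 2 * N * C / K := by
        gcongr
        exact hσ g hg
    _ = _ := by ring

/-! ### Choice of the sets, the words and the parameters -/

/-- Exponentially many bundles of the same size `k` that avoid the item `0` and overlap little:
the graphs of the words of a code, as subsets of the `k * q` items after the item `0`. -/
lemma exists_bundles {n k q : ℕ} [NeZero n] [NeZero q] (hn : k * q + 1 ≤ n) (η : ℝ≥0) (hη1 : η ≤ 1)
    (hη : (4 : ℝ) ≤ (q : ℝ) ^ (η : ℝ)) (Z : Type) [Fintype Z] (hZ : Fintype.card Z ≤ 2 ^ k) :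
    ∃ S : Z → Finset (Fin n), (∀ z, (S z).card = k) ∧ (∀ z, (0 : Fin n) ∉ S z) ∧
      ∀ z z', z ≠ z' → ((S z ∩ S z').card : ℝ≥0) ≤ η * k := by
  classical
  obtain ⟨C, hC, hagree⟩ := exists_code (α := Fin k) (β := Fin q) (η : ℝ) (by exact_mod_cast hη1)
    (by simpa using hη)
  rw [Fintype.card_fin] at hC
  obtain ⟨c⟩ : Nonempty (Z ↪ C) := Function.Embedding.nonempty_of_card_le
    (by simpa using hZ.trans hC)
  let item : Fin k × Fin q → Fin n := fun p =>
    ⟨(finProdFinEquiv p : ℕ) + 1, by have := (finProdFinEquiv p).2; omega⟩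
  have hitem : Function.Injective item := fun p p' h => by
    have h1 : (finProdFinEquiv p : ℕ) = finProdFinEquiv p' := by
      simpa [item] using congrArg Fin.val h
    exact finProdFinEquiv.injective (Fin.ext h1)
  have hgraph : ∀ f : Fin k → Fin q, Function.Injective fun i => item (i, f i) := fun f i i' h =>
    (Prod.mk.inj (hitem h)).1
  refine ⟨fun z => Finset.univ.image fun i => item (i, (c z : Fin k → Fin q) i), fun z => ?_,
    fun z hz => ?_, fun z z' hzz => ?_⟩
  · rw [Finset.card_image_of_injective _ (hgraph _), Finset.card_univ, Fintype.card_fin]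
  · obtain ⟨i, -, hi⟩ := Finset.mem_image.1 hz
    have := congrArg Fin.val hi
    simp [item] at this
  · have hsub : (Finset.univ.image fun i => item (i, (c z : Fin k → Fin q) i)) ∩
        (Finset.univ.image fun i => item (i, (c z' : Fin k → Fin q) i)) ⊆
        (Finset.univ.filter fun i => (c z : Fin k → Fin q) i = (c z' : Fin k → Fin q) i).image
          fun i => item (i, (c z : Fin k → Fin q) i) := by
      intro a ha
      rw [Finset.mem_inter, Finset.mem_image, Finset.mem_image] at ha
      obtain ⟨⟨i, -, rfl⟩, ⟨i', -, hi'⟩⟩ := ha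
      obtain ⟨rfl, h2⟩ := Prod.mk.inj (hitem hi')
      exact Finset.mem_image_of_mem _ (by simpa using h2.symm)
    have h1 := (Finset.card_le_card hsub).trans Finset.card_image_le
    have h2 := hagree _ (c z).2 _ (c z').2 fun h => hzz (c.injective (Subtype.ext h))
    rw [Fintype.card_fin] at h2
    rw [← NNReal.coe_le_coe]
    push_cast
    refine le_trans ?_ h2
    exact_mod_cast h1

/-- The prior, for explicit parameters: its optimal revenue is nearly `5 / 6`, but protocols with
little communication earn hardly more than `2 / 3`. -/
lemma exists_hard_prior {n b l K R : ℕ} (hn : (b + l) * 2 ^ l + 1 ≤ n) (hbl : 0 < b + l)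
    (η : ℝ≥0) (hη1 : η ≤ 1 / 2) (hη : (4 : ℝ) ≤ ((2 ^ l : ℕ) : ℝ) ^ (η : ℝ))
    (hR : 0 < R) (hK : 0 < K) (he : 2 ^ K * (2 / R : ℝ) < 1) {δ : ℝ} (hδ : 0 < δ)
    (hcount : ((3 * (2 ^ n * (R + 1) * (2 * R + 1))) ^ 2 ^ K : ℝ) <
      Real.exp (δ ^ 2 * 2 ^ (2 ^ b - 1) / 2)) :
    ∃ D : PMF (BundleValuation n), (∀ v ∈ D.support, IsXOS v ∧ ∀ S, v S ≤ 1) ∧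
      HasIndependentItems D ∧ ENNReal.ofReal ((5 - 2 * η) / 6) ≤ optimalRevenue D ∧
      ∀ (M : AuctionProtocol n) (ε : ℝ≥0), M.IsAlmostIC D ε → ∀ C : ℝ, 0 ≤ C →
        M.exAnteCommunication D ≤ ENNReal.ofReal C →
        M.revenue D ≤ ENNReal.ofReal (2 / 3 + (δ + 2 * (2 ^ K * (2 / R)) + 3 * ε) / 2 + C / K) := by
  classical
  have : NeZero n := ⟨by omega⟩
  have hηone : η ≤ 1 := hη1.trans (by norm_num)
  obtain ⟨S', hS', h0', hinter'⟩ := exists_bundles hn η hηone hη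
    ((Fin b → Bool) × Fin (2 ^ l)) (by simp [pow_add])
  obtain ⟨C, hC, hagree⟩ := exists_code (α := Fin b → Bool) (β := Fin (2 ^ l)) (η : ℝ)
    (by exact_mod_cast hηone) (by simpa using hη)
  have hcardY : Fintype.card (Fin b → Bool) = 2 ^ b := by simp
  rw [hcardY] at hC hagree
  let J := Fin (2 ^ (2 ^ b - 1))
  have hcardJ : Fintype.card J = 2 ^ (2 ^ b - 1) := Fintype.card_fin _
  have hJ2 : Fintype.card (J × Bool) = 2 ^ 2 ^ b := by
    rw [Fintype.card_prod, hcardJ, Fintype.card_bool, ← pow_succ,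
      Nat.sub_add_cancel Nat.one_le_two_pow]
  obtain ⟨F⟩ : Nonempty (J × Bool ↪ C) := Function.Embedding.nonempty_of_card_le
    (by rw [hJ2]; simpa using hC)
  let S : (Fin b → Bool) → Fin (2 ^ l) → Finset (Fin n) := fun y x => S' (y, x)
  have hS : ∀ y x, (S y x).card = b + l := fun y x => hS' _
  have h0 : ∀ y x, (0 : Fin n) ∉ S y x := fun y x => h0' _
  have hinter : ∀ y x y' x', (y, x) ≠ (y', x') →
      ((S y x ∩ S y' x').card : ℝ≥0) ≤ η * (b + l : ℕ) := fun y x y' x' h => hinter' _ _ h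
  let h : J × Bool → BundleValuation n := fun x => codeValuation 0 S (b + l) 2 (F x).1
  have hle : ∀ t f T, codeValuation 0 S (b + l) (levelOf t) f T ≤ 1 := fun t f T => by
    refine (codeValuation_le hS _ _ T).trans ?_
    cases t <;> norm_num [levelOf]
    rw [← NNReal.coe_le_coe]; norm_num
  have hh : ∀ x T, h x T ≤ 1 := fun x T => by simpa [levelOf] using hle false (F x).1 T
  obtain ⟨σ, hσ⟩ := exists_signs_fooling
    ((utilityClass h R K).image fun g x => clampUnit (g x)) (by
      intro g hg x
      obtain ⟨g', -, rfl⟩ := Finset.mem_image.1 hg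
      exact clampUnit_mem _) δ hδ (by
      refine lt_of_le_of_lt ?_ (by rw [hcardJ]; exact_mod_cast hcount)
      have h1 := three_mul_utilityClass_card_le h R K
      have h2 : (3 * (leafUtilities h R).card) ^ 2 ^ K ≤
          (3 * (2 ^ n * (R + 1) * (2 * R + 1))) ^ 2 ^ K := by
        gcongr
        exact leafUtilities_card_le h R
      have h3 : ((utilityClass h R K).image fun g x => clampUnit (g x)).card ≤
          (utilityClass h R K).card := Finset.card_image_le
      exact_mod_cast (by omega : _ ≤ (3 * (2 ^ n * (R + 1) * (2 * R + 1))) ^ 2 ^ K))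
  let f : J × Bool → (Fin b → Bool) → Fin (2 ^ l) := fun x =>
    if x.2 then (F (x.1, σ x.1)).1 else (F (x.1, !σ x.1)).1
  let val : J × Bool → BundleValuation n := fun x => codeValuation 0 S (b + l) (levelOf x.2) (f x)
  refine ⟨(PMF.uniformOfFintype (J × Bool)).map val, ?_, ?_, ?_, ?_⟩
  · intro v hv
    obtain ⟨x, -, rfl⟩ := (PMF.mem_support_map_iff _ _ _).1 hv
    refine ⟨isXOS_codeValuation hS ?_ _, hle _ _⟩
    rcases x with ⟨j, _ | _⟩ <;> norm_num [levelOf]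
  · exact hasIndependentItems_map _ _ 0 fun x x' T hT => by simp [val, codeValuation, hT]
  · refine le_optimalRevenue_codeValuation hbl hS h0 hη1 hinter f fun j j' => ?_
    have hne : (F (j, !σ j)).1 ≠ (F (j', σ j')).1 := fun heq => by
      obtain ⟨rfl, h2⟩ := Prod.mk.inj (F.injective (Subtype.ext heq))
      simp at h2
    have := hagree _ (F (j, !σ j)).2 _ (F (j', σ j')).2 hne
    rw [← NNReal.coe_le_coe]
    simpa [f] using this
  · intro M ε hM C' hC' hcomm
    refine revenue_le_of_fooled val h σ (fun x T => hle _ _ T) hh (fun j T => ?_) (fun j => ?_) hR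
      hK he (fun g hg => ?_) M hM hC' hcomm
    · simpa [val, h, f, levelOf] using two_mul_codeValuation_one_le hS (F (j, σ j)).1 T
    · simp [val, h, f, levelOf]
    · exact hσ _ (Finset.mem_image_of_mem _ hg)

/-- The union bound is affordable when the depth `K` is half of the length of the words. -/
lemma union_bound_of_lt {n K r : ℕ} (hK : 0 < K) (hr : 0 < r) {δ : ℝ}
    (h : 4 * (18 * (r : ℝ) ^ 2 + n + 2 * K) < δ ^ 2 * 2 ^ K) :
    ((3 * (2 ^ n * (((2 ^ K * r : ℕ) : ℝ) + 1) * (2 * ((2 ^ K * r : ℕ) : ℝ) + 1))) ^ 2 ^ K : ℝ) <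
      Real.exp (δ ^ 2 * 2 ^ (2 * K - 1) / 2) := by
  have hr1 : (1 : ℝ) ≤ r := by exact_mod_cast hr
  have hpow : (1 : ℝ) ≤ 2 ^ K := one_le_pow₀ (by norm_num)
  have hR1 : (1 : ℝ) ≤ 2 ^ K * r := by nlinarith
  have h1 : (3 * (2 ^ n * (((2 ^ K * r : ℕ) : ℝ) + 1) * (2 * ((2 ^ K * r : ℕ) : ℝ) + 1)) : ℝ) ≤
      Real.exp (18 * (r : ℝ) ^ 2 + n + 2 * K) := by
    have he : ∀ m : ℕ, (2 : ℝ) ^ m ≤ Real.exp m := fun m => by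
      rw [← mul_one (m : ℝ), Real.exp_nat_mul]
      gcongr
      linarith [Real.add_one_le_exp 1]
    have h2 : 18 * (r : ℝ) ^ 2 ≤ Real.exp (18 * (r : ℝ) ^ 2) := by
      linarith [Real.add_one_le_exp (18 * (r : ℝ) ^ 2)]
    have h3 := he (2 * K)
    push_cast at h3
    calc (3 * (2 ^ n * (((2 ^ K * r : ℕ) : ℝ) + 1) * (2 * ((2 ^ K * r : ℕ) : ℝ) + 1)) : ℝ)
        ≤ 3 * (2 ^ n * (2 * (2 ^ K * r)) * (3 * (2 ^ K * r))) := by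
          push_cast
          gcongr <;> linarith
      _ = 18 * (r : ℝ) ^ 2 * 2 ^ n * 2 ^ (2 * K) := by rw [two_mul K, pow_add]; ring
      _ ≤ Real.exp (18 * (r : ℝ) ^ 2) * Real.exp n * Real.exp (2 * K) := by
          gcongr
          exact he n
      _ = _ := by rw [← Real.exp_add, ← Real.exp_add]
  calc _ ≤ Real.exp (18 * (r : ℝ) ^ 2 + n + 2 * K) ^ 2 ^ K := by gcongr
    _ = Real.exp (2 ^ K * (18 * (r : ℝ) ^ 2 + n + 2 * K)) := by
      rw [← Real.exp_nat_mul]; push_cast; rfl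
    _ < _ := by
      rw [Real.exp_lt_exp]
      have h4 : (2 : ℝ) ^ (2 * K - 1) * 2 = 2 ^ K * 2 ^ K := by
        rw [← pow_succ, ← pow_add]; congr 1; omega
      nlinarith

/-- Exponentials dominate affine functions, in particular at the depths `2 ^ (b - 1)`. -/
lemma exists_threshold (A B E : ℝ) {δ : ℝ} (hδ : 0 < δ) :
    ∃ b₀ : ℕ, 0 < b₀ ∧ ∀ b, b₀ ≤ b → A + B * ((2 ^ (b - 1) : ℕ) : ℝ) < δ * 2 ^ 2 ^ (b - 1) ∧
      E ≤ 2 ^ b := by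
  have h1 : Filter.Tendsto (fun x : ℕ => A * ((x : ℝ) ^ 0 / 2 ^ x) + B * ((x : ℝ) ^ 1 / 2 ^ x))
      Filter.atTop (nhds (A * 0 + B * 0)) :=
    ((tendsto_pow_const_div_const_pow_of_one_lt 0 (by norm_num)).const_mul A).add
      ((tendsto_pow_const_div_const_pow_of_one_lt 1 (by norm_num)).const_mul B)
  have h2 : Filter.Tendsto (fun b : ℕ => 2 ^ (b - 1)) Filter.atTop (Filter.atTop (α := ℕ)) :=
    (tendsto_pow_atTop_atTop_of_one_lt (by norm_num)).comp (Filter.tendsto_sub_atTop_nat 1)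
  have h3 : Filter.Tendsto (fun b : ℕ => (2 : ℝ) ^ b) Filter.atTop Filter.atTop :=
    tendsto_pow_atTop_atTop_of_one_lt (by norm_num)
  have h4 := h2.eventually (h1.eventually (gt_mem_nhds (show A * 0 + B * 0 < δ by simpa using hδ)))
  obtain ⟨b₀, hb₀⟩ := Filter.eventually_atTop.1 (h4.and (h3.eventually_ge_atTop E))
  refine ⟨b₀ + 1, Nat.succ_pos _, fun b hb => ?_⟩
  obtain ⟨h5, h6⟩ := hb₀ b (by omega)
  refine ⟨?_, h6⟩
  have hpos : (0 : ℝ) < 2 ^ 2 ^ (b - 1) := by positivity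
  have h7 := mul_lt_mul_of_pos_right h5 hpos
  rwa [add_mul, mul_assoc, div_mul_cancel₀ _ hpos.ne', mul_assoc, div_mul_cancel₀ _ hpos.ne',
    pow_zero, mul_one, pow_one] at h7

/-- The worst case over the Buyer's strategies is at least the average over her types. -/
lemma AuctionProtocol.exAnteCommunication_le {n : ℕ} (M : AuctionProtocol n)
    (D : PMF (BundleValuation n)) : M.exAnteCommunication D ≤ M.communicationComplexity := by
  calc M.exAnteCommunication D ≤ ∑' v, D v * M.communicationComplexity :=
        ENNReal.tsum_le_tsum fun v => by
          gcongr
          exact le_iSup (fun s => M.expectedDepth s) _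
    _ = M.communicationComplexity := by rw [ENNReal.tsum_mul_right, D.tsum_coe, one_mul]

end

theorem mainTheorem4 (τ : ℝ) (hτ : 0 < τ) :
    ∃ (c : ℝ) (ε : ℝ≥0) (n₀ : ℕ), 0 < c ∧ 0 < ε ∧ ∀ n : ℕ, n₀ ≤ n →
      ∃ D : PMF (BundleValuation n),
        (∀ v ∈ D.support, IsXOS v ∧ ∀ S, v S ≤ 1) ∧
        HasIndependentItems D ∧
        ∀ M : AuctionProtocol n,
          M.IsAlmostIC D ε →
          ENNReal.ofReal (4 / 5 + τ) * optimalRevenue D ≤ M.revenue D →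
          (2 : ℝ≥0∞) ^ (c * (n : ℝ)) ≤ M.exAnteCommunication D ∧
          (2 : ℝ≥0∞) ^ (c * (n : ℝ)) ≤ M.communicationComplexity := by
  obtain ⟨t, ht0, ht1, htτ⟩ : ∃ t : ℝ, 0 < t ∧ t ≤ 1 ∧ t ≤ τ :=
    ⟨min τ 1, lt_min hτ one_pos, min_le_right _ _, min_le_left _ _⟩
  -- `η` bounds the relative overlaps, and it also serves as the slack in the incentives
  let η : ℝ≥0 := ⟨t / 10, by positivity⟩
  have hη : (η : ℝ) = t / 10 := rfl
  -- the alphabets have `2 ^ l` letters, and the grid has mesh `1 / (2 ^ K * r)`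
  obtain ⟨l, hl⟩ := exists_nat_ge (2 / (η : ℝ))
  obtain ⟨r, hr⟩ := exists_nat_ge (20 / t)
  have hr0 : (0 : ℝ) < r := lt_of_lt_of_le (by positivity) hr
  have hr0' : 0 < r := by exact_mod_cast hr0
  have hηpos : (0 : ℝ) < η := by rw [hη]; positivity
  have hq : (4 : ℝ) ≤ ((2 ^ l : ℕ) : ℝ) ^ (η : ℝ) := by
    have h1 : (2 : ℝ) ≤ l * η := by rwa [div_le_iff₀ hηpos] at hl
    push_cast
    rw [← Real.rpow_natCast, ← Real.rpow_mul (by norm_num)]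
    calc (4 : ℝ) = 2 ^ (2 : ℝ) := by norm_num
      _ ≤ _ := Real.rpow_le_rpow_of_exponent_le (by norm_num) h1
  obtain ⟨b₀, hb₀, hthr⟩ := exists_threshold (4 * (18 * (r : ℝ) ^ 2 + 2 ^ l * (l + 1)))
    (4 * (2 ^ l + 2)) (2 ^ (l + 3) * 100 / t ^ 2) (δ := (t / 10) ^ 2) (by positivity)
  refine ⟨1 / (2 * 2 ^ l), η, 2 ^ l * (b₀ + l) + 1, by positivity, by exact_mod_cast hηpos,
    fun n hn => ?_⟩
  -- bundles have `b + l` items, words have `2 ^ b` positions, and `K` is half of that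
  obtain ⟨b, hb⟩ : ∃ b, (n - 1) / 2 ^ l = b + l ∧ b₀ ≤ b := by
    have h1 : b₀ + l ≤ (n - 1) / 2 ^ l := by
      rw [Nat.le_div_iff_mul_le (by positivity), mul_comm]
      omega
    exact ⟨(n - 1) / 2 ^ l - l, by omega, by omega⟩
  obtain ⟨hbn, hbb⟩ := hb
  have hlow : (b + l) * 2 ^ l + 1 ≤ n := by
    have := Nat.div_mul_le_self (n - 1) (2 ^ l)
    rw [hbn] at this
    omega
  have hup : n ≤ 2 ^ l * (b + l + 1) := by
    have := Nat.lt_mul_div_succ (n - 1) (show 0 < 2 ^ l by positivity)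
    rw [hbn] at this
    omega
  have hupr : (n : ℝ) ≤ 2 ^ l * (b + l + 1) := by exact_mod_cast hup
  obtain ⟨hthr1, hthr2⟩ := hthr b hbb
  set K : ℕ := 2 ^ (b - 1) with hKdef
  have hK0 : 0 < K := by positivity
  have hK0r : (0 : ℝ) < K := by exact_mod_cast hK0
  have hbK : b ≤ K := by
    have := Nat.lt_two_pow_self (n := b - 1)
    omega
  have hbKr : (b : ℝ) ≤ K := by exact_mod_cast hbK
  have h2K : 2 ^ b = 2 * K := by
    rw [hKdef, ← pow_succ', Nat.sub_add_cancel (by omega)]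
  have h2Kr : (2 : ℝ) ^ b = 2 * K := by exact_mod_cast h2K
  have hpowK : (0 : ℝ) < 2 ^ K := by positivity
  have he : (2 : ℝ) ^ K * (2 / ((2 ^ K * r : ℕ) : ℝ)) = 2 / r := by
    push_cast
    field_simp
  have her : 2 / (r : ℝ) ≤ t / 10 := by
    rw [div_le_iff₀ hr0]
    rw [div_le_iff₀ ht0] at hr
    linarith
  obtain ⟨D, hD1, hD2, hD3, hD4⟩ := exists_hard_prior (K := K) (R := 2 ^ K * r) hlow (by omega) η
    (by rw [← NNReal.coe_le_coe, hη]; push_cast; linarith) hq (by positivity) hK0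
    (by rw [he]; linarith) (δ := t / 10) (by positivity) (by
      rw [h2K]
      refine union_bound_of_lt hK0 hr0' (lt_of_le_of_lt ?_ hthr1)
      have : (2 : ℝ) ^ l * (b + l + 1) ≤ 2 ^ l * (K + l + 1) := by gcongr
      linarith)
  refine ⟨D, hD1, hD2, fun M hM hrev => ?_⟩
  have key : (2 : ℝ≥0∞) ^ (1 / (2 * 2 ^ l) * (n : ℝ)) ≤ M.exAnteCommunication D := by
    by_contra hcon
    push Not at hcon
    set C : ℝ := 2 ^ (1 / (2 * 2 ^ l) * (n : ℝ)) with hCdef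
    have hC : (2 : ℝ≥0∞) ^ (1 / (2 * 2 ^ l) * (n : ℝ)) = ENNReal.ofReal C := by
      rw [hCdef, ← ENNReal.ofReal_rpow_of_pos (by norm_num)]
      simp
    have hC0 : 0 ≤ C := by positivity
    have hCK : C / K ≤ t / 10 := by
      rw [div_le_iff₀ hK0r]
      refine (pow_le_pow_iff_left₀ hC0 (by positivity) two_ne_zero).1 ?_
      have h1 : C ^ 2 ≤ 2 ^ (b + l + 1) := by
        rw [hCdef, ← Real.rpow_mul_natCast (by norm_num), ← Real.rpow_natCast 2 (b + l + 1)]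
        refine Real.rpow_le_rpow_of_exponent_le (by norm_num) ?_
        push_cast
        rw [one_div, inv_mul_eq_div, div_mul_eq_mul_div, div_le_iff₀ (by positivity)]
        linarith
      rw [div_le_iff₀ (by positivity)] at hthr2
      have h2 : (2 : ℝ) ^ (b + l + 1) = 2 * K * 2 ^ (l + 1) := by
        rw [add_assoc, pow_add, h2Kr]
      have h3 : (2 : ℝ) ^ (l + 3) = 4 * 2 ^ (l + 1) := by ring
      rw [h3, h2Kr] at hthr2
      rw [h2] at h1
      nlinarith
    have hup := hD4 M η hM C hC0 (by rw [← hC]; exact hcon.le)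
    have hlt : 2 / 3 + (t / 10 + 2 * ((2 : ℝ) ^ K * (2 / ((2 ^ K * r : ℕ) : ℝ))) + 3 * η) / 2 +
        C / K < (4 / 5 + τ) * ((5 - 2 * η) / 6) := by
      rw [he, hη]
      have h1 : (4 / 5 + t) * ((5 - 2 * (t / 10)) / 6) ≤ (4 / 5 + τ) * ((5 - 2 * (t / 10)) / 6) := by
        gcongr
        linarith
      nlinarith
    have hpos : 0 < (4 / 5 + τ) * ((5 - 2 * (η : ℝ)) / 6) := lt_of_le_of_lt (by positivity) hlt
    have h1 := (mul_le_mul_right hD3 (ENNReal.ofReal (4 / 5 + τ))).trans (hrev.trans hup)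
    rw [← ENNReal.ofReal_mul (by positivity)] at h1
    exact absurd ((ENNReal.ofReal_lt_ofReal_iff hpos).2 hlt) (not_lt.2 h1)
  exact ⟨key, key.trans (M.exAnteCommunication_le D)⟩
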